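/- **Conditional list Poisson matching lemma (generalized form).** Let $\mathcal X,\mathcal U,\mathcal Y$ be standard Borel spaces, let $\theta$ be a $\sigma$-finite reference measure on $\mathcal U$, and let $\mu$ be a measure on $\mathcal U$ with density $\mu(u)=\frac{d\mu}{d\theta}(u)\in[0,\infty)$. Let $\Pi=\{(U_i,T_i)\}_{i\in\mathbb N}$ be a Poisson point process on $\mathcal U\times\mathbb R_{\ge 0}$ with intensity measure $\mu\times\lambda$, where $\lambda$ is Lebesgue measure on $\mathbb R_{\ge0}$. Let $J,L\in\mathbb N$ and $K=LJ$, and attach to the points of $\Pi$ labels $Z_i$ that are i.i.d. uniform on $\{1,\dots,J\}$ and independent of $\Pi$. Fix a joint distribution $P_{X,U,Y}$ on $\mathcal X\times\mathcal U\times\mathcal Y$ and a probability kernel $Q_{U|Y}$ such that, almost surely, $P_{U|X}(\cdot|X)\ll\mu$ and $Q_{U|Y}(\cdot|Y)\ll\mu$, and such that these measures have (jointly measurable, $[0,\infty)$-valued) densities $p_{U|X}(\cdot|X)$ and $q_{U|Y}(\cdot|Y)$ with respect to $\theta$. Let $X\sim P_X$ be independent of $(\Pi,(Z_i)_i)$.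 Put $$K_p=\operatorname*{arg\,min}_{i}\ \frac{T_i\,\mu(U_i)}{p_{U|X}(U_i|X)},\qquad U_p=U_{K_p}.$$ Conditionally on $X$, $\Pi$ and $(Z_i)_i$, let $Y_1,\dots,Y_K$ be i.i.d. with law $P_{Y|X,U}(\cdot|X,U_p)$. For $1\le k\le K$ put $$K_{qk}=\operatorname*{arg\,min}_{i:\ Z_i=\lceil k/L\rceil}\ \frac{T_i\,\mu(U_i)}{q_{U|Y}(U_i|Y_k)},\qquad U_{qk}=U_{K_{qk}}.$$ Then: 1. almost surely each of these minimizers exists and is unique, and $U_p$ and all the $U_{qk}$ are random variables; 2. $(X,U_p,Y_k)\sim P_{X,U,Y}$ for every $k$; 3. almost surely, $$\Pr\bigl[U_p\notin\{U_{qk}\}_{k=1}^K\,\big|\,X,U_p,Y_1,\dots,Y_K\bigr]\ \le\ 1-\sum_{j=1}^{J}\Bigl(J+\min_{(j-1)L+1\le k\le jL}\frac{p_{U|X}(U_p|X)}{q_{U|Y}(U_p|Y_k)}\Bigr)^{-1},$$ where $a/0=\infty$ for $a>0$ and $\infty^{-1}=0$; 4. in particular, if $L=1$ (so that $J=K$ and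 decoder $k$ uses only the points with label $k$), almost surely $$\Pr\bigl[U_p\notin\{U_{qk}\}_{k=1}^K\,\big|\,X,U_p,Y_1,\dots,Y_K\bigr]\ \le\ 1-\sum_{k=1}^{K}\Bigl(K+\frac{p_{U|X}(U_p|X)}{q_{U|Y}(U_p|Y_k)}\Bigr)^{-1}.$$ -/

import Mathlib

open MeasureTheory ProbabilityTheory
open scoped NNReal ENNReal

namespace ListPML

/-- The random counting measure `∑ i, δ_{ξ i}` of a random sequence of points. -/
noncomputable def pointMeasure {Ω E : Type*} [MeasurableSpace E] (ξ : ℕ → Ω → E) (ω : Ω) :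
    Measure E :=
  Measure.sum fun i => Measure.dirac (ξ i ω)

/-- The Poisson distribution with mean `r ∈ [0, ∞]`, as a law on `[0, ∞]`; the Poisson
distribution with infinite mean is the point mass at `∞`. -/
noncomputable def poissonLaw (r : ℝ≥0∞) : Measure ℝ≥0∞ :=
  if r = ⊤ then Measure.dirac ⊤ else (poissonMeasure r.toNNReal).map (fun n : ℕ => (n : ℝ≥0∞))

/-- The random points `ξ 0, ξ 1, …` enumerate a Poisson point process with intensity measure `ν`:
the number of points in a measurable set `A` is Poisson with mean `ν A`, and the numbers of
points in finitely many pairwise disjoint measurable sets are independent. -/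
structure IsPoissonProcess {Ω E : Type*} [MeasurableSpace Ω] [MeasurableSpace E]
    (ξ : ℕ → Ω → E) (ν : Measure E) (Pr : Measure Ω) : Prop where
  measurable : ∀ i, Measurable (ξ i)
  hasLaw : ∀ A : Set E, MeasurableSet A →
    HasLaw (fun ω => pointMeasure ξ ω A) (poissonLaw (ν A)) Pr
  indep : ∀ (n : ℕ) (A : Fin n → Set E), (∀ a, MeasurableSet (A a)) →
    Pairwise (fun a b => Disjoint (A a) (A b)) →
    iIndepFun (fun a ω => pointMeasure ξ ω (A a)) Pr

/-- Lebesgue measure on `[0, ∞)`. -/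
noncomputable def lebesgueNNReal : Measure ℝ≥0 :=
  (volume : Measure ℝ).comap (fun t : ℝ≥0 => (t : ℝ))

/-- The kernel `a ↦ κ(a)^{⊗ n}`: the law of `n` i.i.d. samples from `κ(a)`. -/
noncomputable def iidKernel {α β : Type*} [MeasurableSpace α] [MeasurableSpace β]
    (κ : Kernel α β) [IsMarkovKernel κ] (n : ℕ) : Kernel α (Fin n → β) where
  toFun a := Measure.pi fun _ => κ a
  measurable' := by
    refine Measurable.measure_of_isPiSystem_of_isProbabilityMeasure
      generateFrom_pi.symm isPiSystem_pi ?_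
    rintro _ ⟨B, hB, rfl⟩
    simp only [Measure.pi_pi]
    exact Finset.measurable_prod _ fun k _ => κ.measurable_coe (hB k (Set.mem_univ k))

/-- `i` minimizes `s` over the index set `S`. -/
def IsMinimizer (S : Set ℕ) (s : ℕ → ℝ≥0∞) (i : ℕ) : Prop :=
  i ∈ S ∧ ∀ j ∈ S, s i ≤ s j

/-- `argmin_{i ∈ S} s i`: the least minimizer if there is one (and `0` otherwise). -/
noncomputable def argmin (S : Set ℕ) (s : ℕ → ℝ≥0∞) : ℕ :=
  sInf {i | IsMinimizer S s i}

/-- The score `t m(u) / f(u)` of the point `(u, t)` for the density `f`. -/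
noncomputable def score {𝒰 : Type*} (m f : 𝒰 → ℝ≥0) (u : 𝒰) (t : ℝ≥0) : ℝ≥0∞ :=
  (t : ℝ≥0∞) * (m u : ℝ≥0∞) / (f u : ℝ≥0∞)

/-- The density ratio `a / b ∈ [0, ∞]`, which is `∞` for `a > 0 = b`. -/
noncomputable def ratio (a b : ℝ≥0) : ℝ≥0∞ := (a : ℝ≥0∞) / (b : ℝ≥0∞)

end ListPML

set_option linter.unusedSectionVars false

/-! For a probability density `f`, give the point `(u, t)` the score `t m(u) / f(u)`. Points of
score at most `c` have intensity at most `c` (`measure_score_le`), and passing from `p` to `q`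
multiplies the score by the ratio `p / q` (`score_eq_ratio_mul`).

The engine is the Mecke formula `IsPoissonProcess.mecke`: the expected sum, over the points, of a
function of a point and of the remaining points is an integral over the intensity in which the
remaining points are replaced by the whole process. Let the point `z = (u, t)` have `p`-score `s`,
and let `r = p / q` at `u`. The encoder selects `z` when no other point has `p`-score at most `s`. A
decoder of group `j` then finds it if `z` has label `j` and none of the `n` other points of
`q`-score at most `r s` does; given the points, this has probability `(1/J) (1 - 1/J)^n`.
Independence of Poisson counts gives an expectation of at least `(1/J) e^{-(1 + r/J) s}`
(`IsPoissonProcess.expNeg_le_lintegral`), and integration over `t` against `m(u) dt` yields `p(u) /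
(J + r)`. Distinct labels are disjoint events, so these bounds add over `j`, and in each group the
decoder with the least ratio may be used. Since the observations depend on the process only through
the selected `u`, the estimate can be restricted to any event of `(X, U_p, Y)`. This is
`IsCodebook.lintegral_sum_inv_le_measure`, and `condExp_le_one_sub` turns it into the conditional
bound.

The other claims use the same one-sided estimate, `IsCodebook.lintegral_div_le_measure`. Without
labels it shows that the law of `(X, U_p)` dominates `P_{X,U}`; both have mass one, so they agree,
and the encoder's minimizer is almost surely unique. For a decoder, the observation depends on the
selected point, but in the Mecke integral the remaining points form an ordinary Poisson process.
There the conditional probability of a strict minimizer with label `j`, given the points, is at most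
`1` and has mean at least `1`, hence is almost surely `1`; putting the selected point back creates
no tie. -/

namespace ListPML

/-! ### Exponentials and the Poisson law on `[0, ∞]` -/

/-- The function `r ↦ e^{-r}` on `[0, ∞]`. -/
noncomputable def expNeg (r : ℝ≥0∞) : ℝ≥0∞ := EReal.exp (-(r : EReal))

@[simp] lemma expNeg_top : expNeg ⊤ = 0 := by simp [expNeg]

@[simp] lemma expNeg_zero : expNeg 0 = 1 := by simp [expNeg]

lemma expNeg_coe (r : ℝ≥0) : expNeg r = ENNReal.ofReal (Real.exp (-r)) := by
  rw [expNeg, ← EReal.exp_coe]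
  rfl

lemma expNeg_antitone : Antitone expNeg := fun a b h =>
  EReal.exp_monotone (EReal.neg_le_neg_iff.2 (by exact_mod_cast h))

lemma measurable_expNeg : Measurable expNeg := expNeg_antitone.measurable

lemma expNeg_add (a b : ℝ≥0∞) : expNeg (a + b) = expNeg a * expNeg b := by
  induction a with
  | top => simp
  | coe a =>
    induction b with
    | top => simp
    | coe b =>
      rw [← ENNReal.coe_add, expNeg_coe, expNeg_coe, expNeg_coe,
        ← ENNReal.ofReal_mul (Real.exp_pos _).le, ← Real.exp_add]
      congr 2; push_cast; ring

instance (r : ℝ≥0∞) : IsProbabilityMeasure (poissonLaw r) := by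
  unfold poissonLaw; split_ifs <;> infer_instance

lemma lintegral_poissonLaw_top {g : ℝ≥0∞ → ℝ≥0∞} (hg : Measurable g) :
    ∫⁻ v, g v ∂poissonLaw ⊤ = g ⊤ := by
  rw [poissonLaw, if_pos rfl, lintegral_dirac' _ hg]

lemma lintegral_poissonLaw_coe {g : ℝ≥0∞ → ℝ≥0∞} (hg : Measurable g) (r : ℝ≥0) :
    ∫⁻ v, g v ∂poissonLaw r =
      ∑' n : ℕ, ENNReal.ofReal (Real.exp (-r) * r ^ n / n.factorial) * g n := by
  rw [poissonLaw, if_neg (by simp), lintegral_map hg (by fun_prop), poissonMeasure,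
    lintegral_sum_measure]
  simp

/-- The one-dimensional Mecke (Chen–Stein) identity for the Poisson distribution. -/
lemma lintegral_mul_sub_one_poissonLaw {g : ℝ≥0∞ → ℝ≥0∞} (hg : Measurable g) (r : ℝ≥0∞) :
    ∫⁻ v, v * g (v - 1) ∂poissonLaw r = r * ∫⁻ v, g v ∂poissonLaw r := by
  induction r with
  | top =>
    rw [lintegral_poissonLaw_top (by fun_prop), lintegral_poissonLaw_top hg]
    simp
  | coe r =>
    -- The term `n = 0` vanishes; after the shift, `(n + 1) r^(n+1) / (n+1)! = r * r^n / n!`.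
    rw [lintegral_poissonLaw_coe (by fun_prop), lintegral_poissonLaw_coe hg,
      tsum_eq_zero_add' ENNReal.summable, ← ENNReal.tsum_mul_left]
    simp only [Nat.cast_zero, zero_mul, mul_zero, zero_add]
    refine tsum_congr fun n => ?_
    have h1 : ((n + 1 : ℕ) : ℝ≥0∞) - 1 = n := by
      push_cast; exact ENNReal.add_sub_cancel_right (by simp)
    rw [h1, ← mul_assoc, ← mul_assoc]
    congr 1
    rw [← ENNReal.ofReal_natCast, ← ENNReal.ofReal_mul (by positivity),
      ← ENNReal.ofReal_coe_nnreal, ← ENNReal.ofReal_mul (by positivity)]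
    congr 1
    rw [Nat.factorial_succ]
    push_cast
    field_simp
    ring

lemma poissonLaw_zero (r : ℝ≥0∞) : poissonLaw r {0} = expNeg r := by
  have h : poissonLaw r {0} = ∫⁻ v, Set.indicator {0} 1 v ∂poissonLaw r := by
    rw [lintegral_indicator_one (MeasurableSet.singleton _)]
  rw [h]
  have hm : Measurable (Set.indicator {0} 1 : ℝ≥0∞ → ℝ≥0∞) :=
    measurable_one.indicator (MeasurableSet.singleton _)
  induction r with
  | top => rw [lintegral_poissonLaw_top hm]; simp
  | coe r =>
    rw [lintegral_poissonLaw_coe hm, tsum_eq_single 0]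
    · simp [expNeg_coe]
    · intro n hn
      simp [hn]

/-- The function `v ↦ (1 - 1/J) ^ v`, vanishing at `∞`. -/
noncomputable def thin (J : ℕ) (v : ℝ≥0∞) : ℝ≥0∞ :=
  if v = ⊤ then 0 else (1 - (J : ℝ≥0∞)⁻¹) ^ v.toReal

@[simp] lemma thin_top (J : ℕ) : thin J ⊤ = 0 := if_pos rfl

lemma thin_natCast (J n : ℕ) : thin J n = (1 - (J : ℝ≥0∞)⁻¹) ^ n := by
  simp [thin]

lemma measurable_thin (J : ℕ) : Measurable (thin J) :=
  Measurable.ite (MeasurableSet.singleton _) measurable_const (by fun_prop)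

lemma thin_antitone (J : ℕ) : Antitone (thin J) := by
  intro a b hab
  by_cases hb : b = ⊤
  · simp [thin, hb]
  have ha : a ≠ ⊤ := ne_top_of_le_ne_top hb hab
  rw [thin, thin, if_neg ha, if_neg hb]
  exact ENNReal.rpow_le_rpow_of_exponent_ge tsub_le_self (ENNReal.toReal_mono hb hab)

lemma thin_zero (J : ℕ) : thin J 0 = 1 := by simp [thin]

/-- The Poisson generating function at `1 - 1/J`: if each of the counted points carries label `j`
independently with probability `1/J`, this is the probability that none does. -/
lemma lintegral_thin_poissonLaw {J : ℕ} (hJ : J ≠ 0) (r : ℝ≥0∞) :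
    ∫⁻ v, thin J v ∂poissonLaw r = expNeg (r / J) := by
  have hJ1 : (1 : ℝ) ≤ J := by exact_mod_cast Nat.one_le_iff_ne_zero.2 hJ
  induction r with
  | top =>
    rw [lintegral_poissonLaw_top (measurable_thin J), ENNReal.top_div_of_ne_top (by simp)]
    simp
  | coe r =>
    have h1 : (1 : ℝ≥0∞) - (J : ℝ≥0∞)⁻¹ = ENNReal.ofReal (1 - (J : ℝ)⁻¹) := by
      rw [ENNReal.ofReal_sub _ (by positivity), ENNReal.ofReal_inv_of_pos (by positivity)]
      simp
    have h2 : (0 : ℝ) ≤ 1 - (J : ℝ)⁻¹ := by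
      rw [sub_nonneg]; exact inv_le_one_of_one_le₀ hJ1
    have h3 : (r : ℝ≥0∞) / J = ((r / J : ℝ≥0) : ℝ≥0∞) := by
      rw [ENNReal.coe_div (by exact_mod_cast hJ)]; simp
    rw [lintegral_poissonLaw_coe (measurable_thin J), h3, expNeg_coe]
    have key : HasSum (fun n : ℕ => Real.exp (-r) * r ^ n / n.factorial * (1 - (J : ℝ)⁻¹) ^ n)
        (Real.exp (-(r / J : ℝ≥0))) := by
      have := (NormedSpace.expSeries_div_hasSum_exp ((r : ℝ) * (1 - (J : ℝ)⁻¹))).mul_left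
        (Real.exp (-r))
      rw [← Real.exp_eq_exp_ℝ, ← Real.exp_add] at this
      have e : Real.exp (-(r / J : ℝ≥0)) = Real.exp (-r + r * (1 - (J : ℝ)⁻¹)) := by
        congr 1; push_cast; ring
      rw [e]
      refine this.congr_fun fun n => ?_
      rw [mul_pow]; ring
    rw [← key.tsum_eq, ENNReal.ofReal_tsum_of_nonneg (fun n => by positivity) key.summable]
    refine tsum_congr fun n => ?_
    rw [thin_natCast, h1, ← ENNReal.ofReal_pow h2, ← ENNReal.ofReal_mul (by positivity)]

/-! ### Lebesgue measure on `[0, ∞)` -/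

lemma lintegral_lebesgueNNReal {g : ℝ → ℝ≥0∞} (hg : Measurable g) :
    ∫⁻ t, g (t : ℝ≥0) ∂lebesgueNNReal = ∫⁻ t in Set.Ici (0 : ℝ), g t := by
  have h : MeasurableEmbedding (fun t : ℝ≥0 => (t : ℝ)) :=
    MeasurableEmbedding.subtype_coe measurableSet_Ici
  rw [lebesgueNNReal, ← lintegral_map hg h.measurable, h.map_comap]
  congr 2
  ext; simp

lemma lebesgueNNReal_Iic (c : ℝ≥0) : lebesgueNNReal (Set.Iic c) = c := by
  have h : MeasurableEmbedding (fun t : ℝ≥0 => (t : ℝ)) :=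
    MeasurableEmbedding.subtype_coe measurableSet_Ici
  rw [lebesgueNNReal, h.comap_apply]
  have : (fun t : ℝ≥0 => (t : ℝ)) '' Set.Iic c = Set.Icc 0 (c : ℝ) := by
    ext x
    constructor
    · rintro ⟨t, ht, rfl⟩; exact ⟨t.2, by exact_mod_cast ht⟩
    · rintro ⟨h0, h1⟩; exact ⟨⟨x, h0⟩, by exact_mod_cast h1, rfl⟩
  rw [this, Real.volume_Icc]; simp

instance : SigmaFinite lebesgueNNReal :=
  ⟨⟨{ set := fun n : ℕ => Set.Iic (n : ℝ≥0)
      set_mem := fun _ => trivial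
      finite := fun n => by rw [lebesgueNNReal_Iic]; simp
      spanning := Set.iUnion_eq_univ_iff.2 fun t => exists_nat_ge t }⟩⟩

lemma lebesgueNNReal_singleton (t : ℝ≥0) : lebesgueNNReal {t} = 0 := by
  have h : MeasurableEmbedding (fun t : ℝ≥0 => (t : ℝ)) :=
    MeasurableEmbedding.subtype_coe measurableSet_Ici
  rw [lebesgueNNReal, h.comap_apply, Set.image_singleton, Real.volume_singleton]

lemma lebesgueNNReal_univ : lebesgueNNReal Set.univ = ⊤ := by
  refine ENNReal.eq_top_of_forall_nnreal_le fun c => ?_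
  rw [← lebesgueNNReal_Iic]
  exact measure_mono (Set.subset_univ _)

/-- This integrates out the time coordinate of a point. The case `c = ⊤` matters when a density
ratio is infinite: the integrand is then zero off the null set `{0}`. -/
lemma lintegral_expNeg_mul (c : ℝ≥0∞) :
    ∫⁻ t : ℝ≥0, expNeg (c * t) ∂lebesgueNNReal = c⁻¹ := by
  induction c with
  | top =>
    rw [ENNReal.inv_top]
    refine lintegral_eq_zero_of_ae_eq_zero ?_
    have : ∀ᵐ t : ℝ≥0 ∂lebesgueNNReal, t ≠ 0 := by
      simp [ae_iff, lebesgueNNReal_singleton]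
    filter_upwards [this] with t ht
    simp [ENNReal.top_mul, ht]
  | coe c =>
    rcases eq_or_ne c 0 with rfl | hc
    · simp [lebesgueNNReal_univ]
    have hc' : (0 : ℝ) < c := by positivity
    have h1 : ∀ t : ℝ≥0, expNeg ((c : ℝ≥0∞) * t) =
        (fun s : ℝ => ENNReal.ofReal (Real.exp (-c * s))) t := fun t => by
      rw [← ENNReal.coe_mul, expNeg_coe]; push_cast; simp
    simp_rw [h1]
    rw [lintegral_lebesgueNNReal (g := fun s : ℝ => ENNReal.ofReal (Real.exp (-c * s)))
      (by fun_prop), setLIntegral_congr Ioi_ae_eq_Ici.symm,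
      ← ofReal_integral_eq_lintegral_ofReal (integrableOn_exp_mul_Ioi (by linarith) 0)
        (Filter.Eventually.of_forall fun _ => (Real.exp_pos _).le),
      integral_exp_mul_Ioi (by linarith) 0, ← ENNReal.ofReal_coe_nnreal,
      ← ENNReal.ofReal_inv_of_pos hc']
    congr 1; simp

/-! ### The Mecke formula -/

section Mecke

variable {Ω E : Type*} [MeasurableSpace Ω] [MeasurableSpace E]

/-- The counting measure of the points of a random sequence other than the `i`-th one. -/
noncomputable def deletedMeasure (ξ : ℕ → Ω → E) (i : ℕ) (ω : Ω) : Measure E :=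
  Measure.sum fun k => if k = i then 0 else Measure.dirac (ξ k ω)

lemma pointMeasure_apply (ξ : ℕ → Ω → E) (ω : Ω) {A : Set E} (hA : MeasurableSet A) :
    pointMeasure ξ ω A = ∑' i, A.indicator 1 (ξ i ω) := by
  rw [pointMeasure, Measure.sum_apply _ hA]
  exact tsum_congr fun i => Measure.dirac_apply' _ hA

lemma deletedMeasure_apply (ξ : ℕ → Ω → E) (i : ℕ) (ω : Ω) {A : Set E} (hA : MeasurableSet A) :
    deletedMeasure ξ i ω A = ∑' k, if k = i then 0 else A.indicator 1 (ξ k ω) := by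
  rw [deletedMeasure, Measure.sum_apply _ hA]
  refine tsum_congr fun k => ?_
  split_ifs
  · rfl
  · exact Measure.dirac_apply' _ hA

lemma pointMeasure_apply_eq_add (ξ : ℕ → Ω → E) (i : ℕ) (ω : Ω) {A : Set E}
    (hA : MeasurableSet A) :
    pointMeasure ξ ω A = A.indicator 1 (ξ i ω) + deletedMeasure ξ i ω A := by
  rw [pointMeasure_apply ξ ω hA, deletedMeasure_apply ξ i ω hA]
  rw [ENNReal.tsum_eq_add_tsum_ite i]
  congr 1
  refine tsum_congr fun k => ?_
  split_ifs <;> rfl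

lemma deletedMeasure_le (ξ : ℕ → Ω → E) (i : ℕ) (ω : Ω) :
    deletedMeasure ξ i ω ≤ pointMeasure ξ ω :=
  Measure.le_intro fun A hA _ => by
    rw [pointMeasure_apply_eq_add ξ i ω hA]; exact le_add_self

lemma lintegral_deletedMeasure (ξ : ℕ → Ω → E) (i : ℕ) (ω : Ω) {g : E → ℝ≥0∞}
    (hg : Measurable g) :
    ∫⁻ z, g z ∂deletedMeasure ξ i ω = ∑' k, if k = i then 0 else g (ξ k ω) := by
  rw [deletedMeasure, lintegral_sum_measure]
  refine tsum_congr fun k => ?_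
  split_ifs
  · simp
  · exact lintegral_dirac' _ hg

lemma lintegral_pointMeasure (ξ : ℕ → Ω → E) (ω : Ω) {g : E → ℝ≥0∞}
    (hg : Measurable g) :
    ∫⁻ z, g z ∂pointMeasure ξ ω = ∑' k, g (ξ k ω) := by
  rw [pointMeasure, lintegral_sum_measure]
  exact tsum_congr fun k => lintegral_dirac' _ hg

lemma measurable_pointMeasure {ξ : ℕ → Ω → E} (hξ : ∀ i, Measurable (ξ i)) :
    Measurable (pointMeasure ξ) := by
  refine Measure.measurable_of_measurable_coe _ fun A hA => ?_
  simp_rw [pointMeasure_apply _ _ hA]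
  exact Measurable.tsum fun i => (measurable_one.indicator hA).comp (hξ i)

lemma measurable_deletedMeasure {ξ : ℕ → Ω → E} (hξ : ∀ i, Measurable (ξ i)) (i : ℕ) :
    Measurable (deletedMeasure ξ i) := by
  refine Measure.measurable_of_measurable_coe _ fun A hA => ?_
  simp_rw [deletedMeasure_apply _ _ _ hA]
  refine Measurable.tsum fun k => ?_
  split_ifs
  · exact measurable_const
  · exact (measurable_one.indicator hA).comp (hξ k)

variable {ξ : ℕ → Ω → E} {ν : Measure E} {Pr : Measure Ω}

section Classification

variable {S : Type*} [Fintype S] [MeasurableSpace S] [MeasurableSingletonClass S]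

/-- The fibres of a classification into finitely many classes are disjoint, so their counts are
independent Poisson variables. -/
lemma IsPoissonProcess.map_counts (h : IsPoissonProcess ξ ν Pr) {c : E → S} (hc : Measurable c) :
    Pr.map (fun ω s => pointMeasure ξ ω (c ⁻¹' {s})) =
      Measure.pi fun s => poissonLaw (ν (c ⁻¹' {s})) := by
  have hA : ∀ s, MeasurableSet (c ⁻¹' {s}) := fun s => hc (MeasurableSet.singleton s)
  let e := Fintype.equivFin S
  have hind := h.indep (Fintype.card S) (fun a => c ⁻¹' {e.symm a}) (fun a => hA _)
    (fun a b hab => Disjoint.preimage _ (by simpa using hab))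
  have hind' := hind.precomp e.injective
  simp only [Equiv.symm_apply_apply] at hind'
  have hm : ∀ s, Measurable fun ω => pointMeasure ξ ω (c ⁻¹' {s}) := fun s =>
    (Measure.measurable_coe (hA s)).comp (measurable_pointMeasure h.measurable)
  have := iIndepFun.map_fun_eq_pi_map (fun s => (hm s).aemeasurable) hind'
  rw [this]
  congr 1
  ext1 s
  exact (h.hasLaw _ (hA s)).map_eq

/-- Freeze all coordinates but `a` and apply the one-dimensional identity in that coordinate. -/
lemma lintegral_pi_poissonLaw_mul [DecidableEq S] (r : S → ℝ≥0∞) (a : S)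
    {G : (S → ℝ≥0∞) → ℝ≥0∞} (hG : Measurable G) :
    ∫⁻ v, v a * G (Function.update v a (v a - 1)) ∂Measure.pi (fun s => poissonLaw (r s)) =
      r a * ∫⁻ v, G v ∂Measure.pi (fun s => poissonLaw (r s)) := by
  have hm : Measurable fun v : S → ℝ≥0∞ => Function.update v a (v a - 1) := by
    rw [measurable_pi_iff]
    intro s
    rcases eq_or_ne s a with rfl | hs
    · simp only [Function.update_self]; fun_prop
    · simp only [Function.update_of_ne hs]; fun_prop
  rw [← lintegral_const_mul _ hG]
  refine lintegral_eq_of_lmarginal_eq {a} (by fun_prop) (by fun_prop) ?_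
  rw [lmarginal_singleton, lmarginal_singleton]
  ext1 x
  simp only [Function.update_self, Function.update_idem]
  have hm' : Measurable fun v : ℝ≥0∞ => G (Function.update x a v) :=
    hG.comp (measurable_update x)
  rw [lintegral_mul_sub_one_poissonLaw hm', lintegral_const_mul _ hm']

/-- The Mecke formula for functions of the class counts. Deleting a point of class `a` lowers the
count of `a` by one and leaves the others alone, and the number of such points is that count `v a`;
the sum is therefore `v a * G (v - e_a)`. -/
lemma IsPoissonProcess.tsum_lintegral_counts (h : IsPoissonProcess ξ ν Pr) {c : E → S}
    (hc : Measurable c) (a : S) {G : (S → ℝ≥0∞) → ℝ≥0∞} (hG : Measurable G) :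
    ∑' i, ∫⁻ ω, (c ⁻¹' {a}).indicator 1 (ξ i ω) *
        G (fun s => deletedMeasure ξ i ω (c ⁻¹' {s})) ∂Pr =
      ν (c ⁻¹' {a}) * ∫⁻ ω, G (fun s => pointMeasure ξ ω (c ⁻¹' {s})) ∂Pr := by
  classical
  have hA : ∀ s, MeasurableSet (c ⁻¹' {s}) := fun s => hc (MeasurableSet.singleton s)
  have hV : Measurable fun ω s => pointMeasure ξ ω (c ⁻¹' {s}) := measurable_pi_iff.2 fun s =>
    (Measure.measurable_coe (hA s)).comp (measurable_pointMeasure h.measurable)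
  have hVi : ∀ i, Measurable fun ω s => deletedMeasure ξ i ω (c ⁻¹' {s}) := fun i =>
    measurable_pi_iff.2 fun s =>
      (Measure.measurable_coe (hA s)).comp (measurable_deletedMeasure h.measurable i)
  have hm : Measurable fun v : S → ℝ≥0∞ => Function.update v a (v a - 1) := by
    rw [measurable_pi_iff]
    intro s
    rcases eq_or_ne s a with rfl | hs
    · simp only [Function.update_self]; fun_prop
    · simp only [Function.update_of_ne hs]; fun_prop
  have hmeas : ∀ i, Measurable fun ω => (c ⁻¹' {a}).indicator (1 : E → ℝ≥0∞) (ξ i ω) *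
      G (fun s => deletedMeasure ξ i ω (c ⁻¹' {s})) := fun i =>
    ((measurable_one.indicator (hA a)).comp (h.measurable i)).mul (hG.comp (hVi i))
  rw [← lintegral_tsum fun i => (hmeas i).aemeasurable]
  have hpt : ∀ ω, ∑' i, (c ⁻¹' {a}).indicator 1 (ξ i ω) *
      G (fun s => deletedMeasure ξ i ω (c ⁻¹' {s})) =
      (fun v : S → ℝ≥0∞ => v a * G (Function.update v a (v a - 1)))
        (fun s => pointMeasure ξ ω (c ⁻¹' {s})) := by
    intro ω
    simp only
    rw [pointMeasure_apply ξ ω (hA a), ← ENNReal.tsum_mul_right]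
    refine tsum_congr fun i => ?_
    by_cases hi : ξ i ω ∈ c ⁻¹' {a}
    · congr 2
      ext s
      rcases eq_or_ne s a with rfl | hs
      · rw [Function.update_self, ← pointMeasure_apply ξ ω (hA s),
          pointMeasure_apply_eq_add ξ i ω (hA s), Set.indicator_of_mem hi, Pi.one_apply,
          ENNReal.add_sub_cancel_left (by simp)]
      · rw [Function.update_of_ne hs, pointMeasure_apply_eq_add ξ i ω (hA s),
          Set.indicator_of_notMem, zero_add]
        intro hi'
        exact hs (hi'.symm.trans hi)
    · simp [Set.indicator_of_notMem hi]
  simp_rw [hpt]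
  rw [← lintegral_map (f := fun v : S → ℝ≥0∞ => v a * G (Function.update v a (v a - 1)))
      (by fun_prop) hV, ← lintegral_map hG hV, h.map_counts hc, lintegral_pi_poissonLaw_mul _ _ hG]

end Classification

/-- Counting measures are determined by the finite-dimensional vectors of their counts. -/
lemma generateFrom_piiUnionInter_counts :
    MeasurableSpace.generateFrom (piiUnionInter (fun B : {B : Set E // MeasurableSet B} =>
      {s | MeasurableSet[(borel ℝ≥0∞).comap fun M : Measure E => M B] s}) Set.univ) =
      (inferInstance : MeasurableSpace (Measure E)) := by
  refine (generateFrom_piiUnionInter_measurableSet (fun B : {B : Set E // MeasurableSet B} =>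
    (borel ℝ≥0∞).comap fun M : Measure E => M B) Set.univ).trans ?_
  refine le_antisymm ?_ ?_
  · refine iSup₂_le fun B _ => ?_
    exact le_iSup₂_of_le B.1 B.2 le_rfl
  · refine iSup₂_le fun B hB => ?_
    exact le_iSup₂_of_le ⟨B, hB⟩ (Set.mem_univ _) le_rfl

/-- The Mecke formula, as an identity of measures. -/
lemma IsPoissonProcess.prod_eq_sum [SigmaFinite ν] [IsProbabilityMeasure Pr]
    (h : IsPoissonProcess ξ ν Pr) :
    ν.prod (Pr.map (pointMeasure ξ)) =
      Measure.sum fun i => Pr.map fun ω => (ξ i ω, deletedMeasure ξ i ω) := by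
  classical
  have hN := measurable_pointMeasure h.measurable
  have hNi := measurable_deletedMeasure h.measurable
  have : IsProbabilityMeasure (Pr.map (pointMeasure ξ)) :=
    Measure.isProbabilityMeasure_map hN.aemeasurable
  -- It suffices to compare both sides on products of a measurable set with an event about finitely
  -- many counts. The law of the process is finite, so the whole space serves as its spanning
  -- sequence.
  refine Measure.prod_eq_generateFrom MeasurableSpace.generateFrom_measurableSet
    generateFrom_piiUnionInter_counts MeasurableSpace.isPiSystem_measurableSet
    (isPiSystem_piiUnionInter _ (fun B =>
      @MeasurableSpace.isPiSystem_measurableSet _ ((borel ℝ≥0∞).comap _)) _)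
    ν.toFiniteSpanningSetsIn
    ⟨fun _ => Set.univ, fun _ => ⟨∅, by simp, fun _ => Set.univ, by simp, by simp⟩,
      fun _ => measure_lt_top _ _, by simp [Set.iUnion_const]⟩ ?_
  rintro A hA t ht
  have hA' : MeasurableSet A := hA
  have htm : MeasurableSet t := by
    have := MeasurableSpace.measurableSet_generateFrom ht
    rwa [generateFrom_piiUnionInter_counts] at this
  obtain ⟨I, -, f, hf, rfl⟩ := ht
  choose! D hD hDf using hf
  -- Classify points by membership in `A` and in each of the finitely many test sets; every count in
  -- question is a sum of counts over the fibres of `c`.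
  let c : E → Prop × (I → Prop) := fun z => (z ∈ A, fun B => z ∈ B.1.1)
  have hc : Measurable c :=
    (measurableSet_setOfPred.1 hA').prodMk (measurable_pi_iff.2 fun B => measurableSet_setOfPred.1 B.1.2)
  have hcm : ∀ y : Prop × (I → Prop), MeasurableSet (c ⁻¹' {y}) := fun y =>
    hc (MeasurableSet.singleton y)
  have hcount : ∀ (M : Measure E) (B : I), M B.1.1 =
      ∑ y ∈ Finset.univ.filter (fun y : Prop × (I → Prop) => y.2 B), M (c ⁻¹' {y}) := by
    intro M B
    rw [sum_measure_preimage_singleton _ fun y _ => hcm y]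
    congr 1
    ext z
    simp [c]
  -- The event `⋂ B ∈ I, f B`, read as a condition on the vector of fibre counts.
  let W : Set ((Prop × (I → Prop)) → ℝ≥0∞) := {v | ∀ B : I,
    ∑ y ∈ Finset.univ.filter (fun y : Prop × (I → Prop) => y.2 B), v y ∈ D B.1}
  have hW : MeasurableSet W := by
    refine measurableSet_setOfPred.2 (Measurable.forall fun B => ?_)
    refine measurableSet_setOfPred.1 ?_
    exact (Finset.measurable_fun_sum _ fun y _ => measurable_pi_apply y) (hD B.1 B.2)
  have hmem : ∀ M : Measure E, M ∈ (⋂ B ∈ I, f B) ↔ (fun y => M (c ⁻¹' {y})) ∈ W := by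
    intro M
    simp only [Set.mem_iInter, W, Set.mem_ofPred_eq]
    constructor
    · intro hM B
      have := hM B.1 B.2
      rw [← hDf B.1 B.2] at this
      rw [← hcount M B]
      exact this
    · intro hM B hB
      rw [← hDf B hB]
      have := hM ⟨B, hB⟩
      rw [← hcount M ⟨B, hB⟩] at this
      exact this
  have hG : Measurable (W.indicator (1 : ((Prop × (I → Prop)) → ℝ≥0∞) → ℝ≥0∞)) :=
    measurable_one.indicator hW
  have hind : ∀ M : Measure E, W.indicator 1 (fun y => M (c ⁻¹' {y})) =
      (⋂ B ∈ I, f B).indicator (1 : Measure E → ℝ≥0∞) M := by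
    intro M
    by_cases hM : M ∈ ⋂ B ∈ I, f B
    · rw [Set.indicator_of_mem hM, Set.indicator_of_mem ((hmem M).1 hM)]; rfl
    · rw [Set.indicator_of_notMem hM, Set.indicator_of_notMem (fun h' => hM ((hmem M).2 h'))]
  have hAc : ∀ M : Measure E, M A =
      ∑ y ∈ Finset.univ.filter (fun y : Prop × (I → Prop) => y.1), M (c ⁻¹' {y}) := by
    intro M
    rw [sum_measure_preimage_singleton _ fun y _ => hcm y]
    congr 1
    ext z
    simp [c]
  have hAi : ∀ z, A.indicator (1 : E → ℝ≥0∞) z =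
      ∑ y ∈ Finset.univ.filter (fun y : Prop × (I → Prop) => y.1),
        (c ⁻¹' {y}).indicator 1 z := by
    intro z
    have := hAc (Measure.dirac z)
    rw [Measure.dirac_apply' _ hA'] at this
    rw [this]
    exact Finset.sum_congr rfl fun y _ => Measure.dirac_apply' _ (hcm y)
  rw [Measure.sum_apply _ (hA'.prod htm), hAc ν, Finset.sum_mul]
  have h1 : ∀ i, Pr.map (fun ω => (ξ i ω, deletedMeasure ξ i ω)) (A ×ˢ ⋂ B ∈ I, f B) =
      ∑ y ∈ Finset.univ.filter (fun y : Prop × (I → Prop) => y.1),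
        ∫⁻ ω, (c ⁻¹' {y}).indicator 1 (ξ i ω) *
          W.indicator 1 (fun s => deletedMeasure ξ i ω (c ⁻¹' {s})) ∂Pr := by
    intro i
    have hmi : ∀ y : Prop × (I → Prop),
        Measurable fun ω => (c ⁻¹' {y}).indicator (1 : E → ℝ≥0∞) (ξ i ω) := fun y =>
      (measurable_one.indicator (hcm y)).comp (h.measurable i)
    have hmt : Measurable fun ω =>
        (⋂ B ∈ I, f B).indicator (1 : Measure E → ℝ≥0∞) (deletedMeasure ξ i ω) :=
      (measurable_one.indicator htm).comp (hNi i)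
    simp_rw [hind]
    have hmit : ∀ y : Prop × (I → Prop), Measurable fun ω =>
        (c ⁻¹' {y}).indicator (1 : E → ℝ≥0∞) (ξ i ω) *
          (⋂ B ∈ I, f B).indicator (1 : Measure E → ℝ≥0∞) (deletedMeasure ξ i ω) := fun y =>
      (hmi y).mul hmt
    rw [← lintegral_finsetSum _ fun y _ => hmit y,
      ← lintegral_indicator_one (hA'.prod htm),
      lintegral_map (measurable_one.indicator (hA'.prod htm)) ((h.measurable i).prodMk (hNi i))]
    refine lintegral_congr fun ω => ?_
    rw [← Finset.sum_mul, ← hAi]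
    simp only [Set.indicator_apply, Set.mem_prod, Pi.one_apply]
    split_ifs <;> simp_all
  simp_rw [h1]
  rw [Summable.tsum_finsetSum fun _ _ => ENNReal.summable]
  refine Finset.sum_congr rfl fun y _ => ?_
  rw [h.tsum_lintegral_counts hc y hG]
  congr 1
  simp_rw [hind]
  rw [← lintegral_indicator_one htm, lintegral_map (measurable_one.indicator htm) hN]

/-- The Mecke formula. -/
theorem IsPoissonProcess.mecke [SigmaFinite ν] [IsProbabilityMeasure Pr]
    (h : IsPoissonProcess ξ ν Pr) {F : E × Measure E → ℝ≥0∞} (hF : Measurable F) :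
    ∑' i, ∫⁻ ω, F (ξ i ω, deletedMeasure ξ i ω) ∂Pr =
      ∫⁻ z, ∫⁻ ω, F (z, pointMeasure ξ ω) ∂Pr ∂ν := by
  have hN := measurable_pointMeasure h.measurable
  have : IsProbabilityMeasure (Pr.map (pointMeasure ξ)) :=
    Measure.isProbabilityMeasure_map hN.aemeasurable
  have h1 : ∫⁻ x, F x ∂(ν.prod (Pr.map (pointMeasure ξ))) =
      ∫⁻ z, ∫⁻ ω, F (z, pointMeasure ξ ω) ∂Pr ∂ν := by
    rw [lintegral_prod _ hF.aemeasurable]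
    refine lintegral_congr fun z => ?_
    rw [lintegral_map (by fun_prop) hN]
  rw [← h1, h.prod_eq_sum, lintegral_sum_measure]
  refine tsum_congr fun i => ?_
  rw [lintegral_map hF ((h.measurable i).prodMk (measurable_deletedMeasure h.measurable i))]

end Mecke

/-! ### An s-finite substitute for the identity kernel on measures -/

section LocallyFinite

variable {E : Type*} [MeasurableSpace E]

/-- The kernel `N ↦ N|_A / N(A)`, and `0` if `N(A) = ∞`. -/
noncomputable def normalizedRestrict (A : Set E) (hA : MeasurableSet A) : Kernel (Measure E) E where
  toFun N := (N A)⁻¹ • N.restrict A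
  measurable' := by
    refine Measure.measurable_of_measurable_coe _ fun B hB => ?_
    simp only [Measure.smul_apply, smul_eq_mul, Measure.restrict_apply hB]
    exact (Measure.measurable_coe hA).inv.mul (Measure.measurable_coe (hB.inter hA))

instance (A : Set E) (hA : MeasurableSet A) : IsFiniteKernel (normalizedRestrict A hA) :=
  ⟨⟨1, ENNReal.one_lt_top, fun N => by
    change ((N A)⁻¹ • N.restrict A) Set.univ ≤ 1
    rw [Measure.smul_apply, Measure.restrict_apply_univ, smul_eq_mul]
    exact ENNReal.inv_mul_le_one _⟩⟩

/-- The kernel `N ↦ N|_A`, and `0` if `N(A) = ∞`. -/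
noncomputable def finiteRestrict (A : Set E) (hA : MeasurableSet A) : Kernel (Measure E) E :=
  (normalizedRestrict A hA).withDensity fun N _ => if N A = ⊤ then 0 else N A

instance (A : Set E) (hA : MeasurableSet A) : IsSFiniteKernel (finiteRestrict A hA) :=
  Kernel.IsSFiniteKernel.withDensity _ fun N _ => by split_ifs with h <;> simp [h]

lemma finiteRestrict_apply {A : Set E} (hA : MeasurableSet A) {N : Measure E} (hN : N A ≠ ⊤) :
    finiteRestrict A hA N = N.restrict A := by
  have hm : Measurable (Function.uncurry fun (N : Measure E) (_ : E) =>
      if N A = ⊤ then 0 else N A) := by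
    refine Measurable.ite ?_ measurable_const ?_
    · exact ((Measure.measurable_coe hA).comp measurable_fst) (MeasurableSet.singleton ⊤)
    · exact (Measure.measurable_coe hA).comp measurable_fst
  rw [finiteRestrict, Kernel.withDensity_apply _ hm]
  simp only [hN, if_false]
  rw [withDensity_const]
  change N A • (N A)⁻¹ • N.restrict A = _
  rcases eq_or_ne (N A) 0 with h0 | h0
  · rw [Measure.restrict_eq_zero.2 h0]; simp
  · rw [smul_smul, ENNReal.mul_inv_cancel h0 hN, one_smul]

/-- An s-finite version of the identity kernel `N ↦ N` on the measures that are finite on the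
sets of `spanningSets ν`. -/
noncomputable def locFin (ν : Measure E) [SigmaFinite ν] : Kernel (Measure E) E :=
  Kernel.sum fun n => finiteRestrict (disjointed (spanningSets ν) n)
    (MeasurableSet.disjointed (measurableSet_spanningSets ν) n)

instance (ν : Measure E) [SigmaFinite ν] : IsSFiniteKernel (locFin ν) :=
  Kernel.isSFiniteKernel_sum (hκs := fun _ => inferInstance)

lemma locFin_apply {ν : Measure E} [SigmaFinite ν] {N : Measure E}
    (hN : ∀ n, N (spanningSets ν n) < ⊤) : locFin ν N = N := by
  have h : ∀ n, finiteRestrict (disjointed (spanningSets ν) n)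
      (MeasurableSet.disjointed (measurableSet_spanningSets ν) n) N =
      N.restrict (disjointed (spanningSets ν) n) := fun n =>
    finiteRestrict_apply _ ((measure_mono (disjointed_subset _ n)).trans_lt (hN n)).ne
  rw [locFin, Kernel.sum_apply]
  simp_rw [h]
  rw [← Measure.restrict_iUnion (disjoint_disjointed _)
    (fun n => MeasurableSet.disjointed (measurableSet_spanningSets ν) n), iUnion_disjointed,
    iUnion_spanningSets, Measure.restrict_univ]

end LocallyFinite

/-! ### Almost sure finiteness, null sets and void probabilities -/

section Void

variable {Ω E : Type*} [MeasurableSpace Ω] [MeasurableSpace E]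
  {ξ : ℕ → Ω → E} {ν : Measure E} {Pr : Measure Ω}

lemma poissonLaw_singleton_top {r : ℝ≥0∞} (hr : r ≠ ⊤) : poissonLaw r {⊤} = 0 := by
  rw [poissonLaw, if_neg hr, Measure.map_apply (by fun_prop) (MeasurableSet.singleton _)]
  have : (fun n : ℕ => (n : ℝ≥0∞)) ⁻¹' {⊤} = ∅ := by ext n; simp
  simp [this]

lemma IsPoissonProcess.ae_lt_top (h : IsPoissonProcess ξ ν Pr) {A : Set E} (hA : MeasurableSet A)
    (hνA : ν A ≠ ⊤) : ∀ᵐ ω ∂Pr, pointMeasure ξ ω A < ⊤ := by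
  have := (h.hasLaw A hA).measure_eq (p := fun v => v = ⊤) (MeasurableSet.singleton _)
  rw [ae_iff]
  simpa only [not_lt, top_le_iff] using this.trans (poissonLaw_singleton_top hνA)

/-- The spanning sets have finite mean count, hence almost surely finite count, and deleting a point
only lowers counts. -/
lemma IsPoissonProcess.ae_locFin_eq [SigmaFinite ν] (h : IsPoissonProcess ξ ν Pr) :
    ∀ᵐ ω ∂Pr, (∀ i, locFin ν (deletedMeasure ξ i ω) = deletedMeasure ξ i ω) ∧
      locFin ν (pointMeasure ξ ω) = pointMeasure ξ ω := by
  have : ∀ᵐ ω ∂Pr, ∀ n, pointMeasure ξ ω (spanningSets ν n) < ⊤ := ae_all_iff.2 fun n =>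
    h.ae_lt_top (measurableSet_spanningSets ν n) (measure_spanningSets_lt_top ν n).ne
  filter_upwards [this] with ω hω
  exact ⟨fun i => locFin_apply fun n => (deletedMeasure_le ξ i ω _).trans_lt (hω n),
    locFin_apply hω⟩

lemma IsPoissonProcess.ae_eq_zero (h : IsPoissonProcess ξ ν Pr) {A : Set E} (hA : MeasurableSet A)
    (hνA : ν A = 0) : ∀ᵐ ω ∂Pr, pointMeasure ξ ω A = 0 := by
  have := (h.hasLaw A hA).measure_eq (p := fun v => v ≠ 0) (MeasurableSet.singleton 0).compl
  rw [ae_iff, this, hνA]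
  change poissonLaw 0 {0}ᶜ = 0
  rw [prob_compl_eq_zero_iff (MeasurableSet.singleton _), poissonLaw_zero, expNeg_zero]

/-- The indicator function of `{0}` on `[0, ∞]`. -/
noncomputable def isZero (v : ℝ≥0∞) : ℝ≥0∞ := Set.indicator {0} 1 v

lemma measurable_isZero : Measurable isZero :=
  measurable_one.indicator (MeasurableSet.singleton 0)

@[simp] lemma isZero_zero : isZero 0 = 1 := by simp [isZero]

lemma isZero_of_ne {v : ℝ≥0∞} (hv : v ≠ 0) : isZero v = 0 := by simp [isZero, hv]

/-- The counts of `R₁` and `R₂ \ R₁` are independent, and when `R₁` is empty of points the second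
one bounds the count of `R₂`. Only an inequality results, because `ν (R₂ \ R₁)` is replaced by `ν
R₂`. -/
lemma IsPoissonProcess.expNeg_le_lintegral (h : IsPoissonProcess ξ ν Pr) {J : ℕ}
    (hJ : J ≠ 0) {R₁ R₂ : Set E} (h₁ : MeasurableSet R₁) (h₂ : MeasurableSet R₂) :
    expNeg (ν R₁ + ν R₂ / J) ≤
      ∫⁻ ω, isZero (pointMeasure ξ ω R₁) * thin J (pointMeasure ξ ω R₂) ∂Pr := by
  have hN : ∀ {A : Set E}, MeasurableSet A → Measurable fun ω => pointMeasure ξ ω A :=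
    fun hA => (Measure.measurable_coe hA).comp (measurable_pointMeasure h.measurable)
  have hind := h.indep 2 ![R₁, R₂ \ R₁] (by
    intro a; fin_cases a
    · exact h₁
    · exact h₂.diff h₁) (by
    intro a b hab
    fin_cases a <;> fin_cases b
    · exact absurd rfl hab
    · exact Set.disjoint_sdiff_right
    · exact Set.disjoint_sdiff_left
    · exact absurd rfl hab)
  have hind' : IndepFun (fun ω => pointMeasure ξ ω R₁) (fun ω => pointMeasure ξ ω (R₂ \ R₁)) Pr :=
    hind.indepFun (i := 0) (j := 1) (by simp)
  have hind2 := hind'.comp measurable_isZero (measurable_thin J)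
  have h3 : ∫⁻ ω, isZero (pointMeasure ξ ω R₁) ∂Pr = expNeg (ν R₁) := by
    have := lintegral_map (μ := Pr) measurable_isZero (hN h₁)
    rw [← this, (h.hasLaw _ h₁).map_eq, ← poissonLaw_zero]
    exact lintegral_indicator_one (MeasurableSet.singleton _)
  have h4 : ∫⁻ ω, thin J (pointMeasure ξ ω (R₂ \ R₁)) ∂Pr = expNeg (ν (R₂ \ R₁) / J) := by
    have := lintegral_map (μ := Pr) (measurable_thin J) (hN (h₂.diff h₁))
    rw [← this, (h.hasLaw _ (h₂.diff h₁)).map_eq, lintegral_thin_poissonLaw hJ]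
  calc expNeg (ν R₁ + ν R₂ / J) ≤ expNeg (ν R₁) * expNeg (ν (R₂ \ R₁) / J) := by
        rw [expNeg_add]
        gcongr
        refine expNeg_antitone ?_
        gcongr
        exact Set.sdiff_subset
    _ = ∫⁻ ω, isZero (pointMeasure ξ ω R₁) * thin J (pointMeasure ξ ω (R₂ \ R₁)) ∂Pr := by
        rw [← h3, ← h4]
        exact (lintegral_mul_eq_lintegral_mul_lintegral_of_indepFun
          (measurable_isZero.comp (hN h₁)) ((measurable_thin J).comp (hN (h₂.diff h₁))) hind2).symm
    _ ≤ _ := by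
        refine lintegral_mono fun ω => ?_
        by_cases h0 : pointMeasure ξ ω R₁ = 0
        · gcongr
          refine thin_antitone J ?_
          calc pointMeasure ξ ω R₂ ≤ pointMeasure ξ ω (R₁ ∪ R₂ \ R₁) :=
                measure_mono (by rw [Set.union_sdiff_self]; exact Set.subset_union_right)
            _ ≤ pointMeasure ξ ω R₁ + pointMeasure ξ ω (R₂ \ R₁) := measure_union_le _ _
            _ = _ := by rw [h0, zero_add]
        · simp [isZero_of_ne h0]

end Void

/-! ### Probabilities of label patterns -/

section Labels

variable {Ω : Type*} [MeasurableSpace Ω] {Pr : Measure Ω} {J : ℕ} {Z : ℕ → Ω → Fin J}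

lemma measure_label_eq {i : ℕ} (hZ : HasLaw (Z i) (uniformOn Set.univ) Pr) (j : Fin J) :
    Pr (Z i ⁻¹' {j}) = (J : ℝ≥0∞)⁻¹ := by
  have := hZ.measure_eq (p := fun z => z = j) (MeasurableSet.singleton j)
  refine this.trans ?_
  have hJ : NeZero J := ⟨fun h => by subst h; exact j.elim0⟩
  rw [uniformOn_univ]
  simp

/-- The point `i` has label `j`, and no point in `I` does. -/
lemma inv_mul_thin_le_measure_labels [IsProbabilityMeasure Pr]
    (hZm : ∀ i, Measurable (Z i)) (hZ : ∀ i, HasLaw (Z i) (uniformOn Set.univ) Pr)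
    (hZi : iIndepFun Z Pr) (i : ℕ) (j : Fin J) {I : Set ℕ} (hi : i ∉ I) :
    (J : ℝ≥0∞)⁻¹ * thin J (∑' k, I.indicator 1 k) ≤ Pr {ω | Z i ω = j ∧ ∀ k ∈ I, Z k ω ≠ j} := by
  -- For finite `I` this is independence of the labels over `insert i I`; for infinite `I` the bound
  -- is zero.
  by_cases hI : I.Finite
  · lift I to Finset ℕ using hI
    have hcount : ∑' k, (I : Set ℕ).indicator (1 : ℕ → ℝ≥0∞) k = (I.card : ℝ≥0∞) := by
      rw [tsum_eq_sum (s := I) fun k hk => by simp [hk], Finset.sum_congr rfl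
        (g := fun _ => (1 : ℝ≥0∞)) fun k hk => by simp [hk]]
      simp
    have := hZi.measure_inter_preimage_eq_mul (insert i I)
      (sets := fun k => if k = i then {j} else {j}ᶜ) (fun k _ => by measurability)
    have hi' : i ∉ I := by simpa using hi
    rw [Finset.prod_insert hi', if_pos rfl, measure_label_eq (hZ i)] at this
    have h2 : ∀ k ∈ I, Pr (Z k ⁻¹' (if k = i then {j} else {j}ᶜ)) = 1 - (J : ℝ≥0∞)⁻¹ := by
      intro k hk
      have h3 : k ≠ i := fun h => hi' (h ▸ hk)
      rw [if_neg h3, Set.preimage_compl,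
        prob_compl_eq_one_sub (hZm k (MeasurableSet.singleton j)), measure_label_eq (hZ k)]
    rw [Finset.prod_congr rfl h2, Finset.prod_const] at this
    rw [hcount, thin_natCast, ← this]
    refine measure_mono fun ω hω => ?_
    simp only [Set.mem_iInter, Finset.mem_insert] at hω
    refine ⟨by simpa using hω i (Or.inl rfl), fun k hk => ?_⟩
    have h3 : k ≠ i := fun h => hi' (h ▸ hk)
    simpa [h3] using hω k (Or.inr hk)
  · have : ∑' k, I.indicator (1 : ℕ → ℝ≥0∞) k = ⊤ := by
      rw [← tsum_subtype I (1 : ℕ → ℝ≥0∞)]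
      have : Infinite I := Set.infinite_coe_iff.2 hI
      exact ENNReal.tsum_const_eq_top_of_ne_zero one_ne_zero
    rw [this, thin_top, mul_zero]
    exact zero_le

end Labels

/-! ### Scores and the intensity measure -/

section Intensity

variable {𝒰 : Type*} [MeasurableSpace 𝒰] {θ : Measure 𝒰} {m h : 𝒰 → ℝ≥0}

@[fun_prop]
lemma measurable_score {α : Type*} [MeasurableSpace α] {m : 𝒰 → ℝ≥0} {h : α → 𝒰 → ℝ≥0}
    {u : α → 𝒰} {t : α → ℝ≥0} (hm : Measurable m) (hh : Measurable (Function.uncurry h))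
    (hu : Measurable u) (ht : Measurable t) :
    Measurable fun a => score m (h a) (u a) (t a) := by
  have h1 : Measurable fun a => h a (u a) := hh.comp (measurable_id.prodMk hu)
  unfold score
  fun_prop

/-- For nonzero `m` and `h` the set is contained in `[0, c h / m]`, whose length times `m` is `h c`.
-/
lemma mul_lebesgueNNReal_score_le (m h c : ℝ≥0) :
    (m : ℝ≥0∞) * lebesgueNNReal {t : ℝ≥0 | (t : ℝ≥0∞) * m / h ≤ c} ≤ h * c := by
  rcases eq_or_ne m 0 with rfl | hm
  · simp
  -- When `h = 0` every `t ≠ 0` has infinite score, and `t = 0` (where `0 / 0 = 0`) is a null set.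
  rcases eq_or_ne h 0 with rfl | hh
  · have : {t : ℝ≥0 | (t : ℝ≥0∞) * m / (0 : ℝ≥0) ≤ c} ⊆ {0} := by
      intro t ht
      by_contra h0
      have h1 : (t : ℝ≥0∞) * m ≠ 0 := by simp [hm]; simpa using h0
      simp only [Set.mem_ofPred_eq, ENNReal.coe_zero, ENNReal.div_zero h1, top_le_iff] at ht
      exact ENNReal.coe_ne_top ht
    rw [measure_mono_null this (lebesgueNNReal_singleton 0)]
    simp
  have : {t : ℝ≥0 | (t : ℝ≥0∞) * m / h ≤ c} ⊆ Set.Iic (c * h / m) := by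
    intro t ht
    simp only [Set.mem_ofPred_eq] at ht
    rw [← ENNReal.coe_mul, ← ENNReal.coe_div hh, ENNReal.coe_le_coe] at ht
    rw [Set.mem_Iic, le_div_iff₀ (by positivity)]
    rwa [div_le_iff₀ (by positivity)] at ht
  calc (m : ℝ≥0∞) * lebesgueNNReal {t : ℝ≥0 | (t : ℝ≥0∞) * m / h ≤ c}
      ≤ m * ((c * h / m : ℝ≥0) : ℝ≥0∞) := by
        rw [← lebesgueNNReal_Iic (c * h / m)]; gcongr
    _ = h * c := by
        rw [← ENNReal.coe_mul, ← ENNReal.coe_mul]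
        congr 1
        field_simp

variable [SigmaFinite θ]

instance sigmaFinite_withDensity_nnreal : SigmaFinite (θ.withDensity fun u => (m u : ℝ≥0∞)) :=
  SigmaFinite.withDensity m

/-- The scores below `c` carry mass at most `c`. -/
lemma measure_score_le (hm : Measurable m) (hh : Measurable h)
    [IsProbabilityMeasure (θ.withDensity fun u => (h u : ℝ≥0∞))] (c : ℝ≥0∞) :
    ((θ.withDensity fun u => (m u : ℝ≥0∞)).prod lebesgueNNReal)
      {z | score m h z.1 z.2 ≤ c} ≤ c := by
  induction c with
  | top => exact le_top
  | coe c =>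
    have hs : MeasurableSet {z : 𝒰 × ℝ≥0 | score m h z.1 z.2 ≤ c} :=
      measurableSet_le (by fun_prop) measurable_const
    rw [Measure.prod_apply hs,
      lintegral_withDensity_eq_lintegral_mul _ (by fun_prop) (measurable_measure_prodMk_left hs)]
    calc _ ≤ ∫⁻ u, (h u : ℝ≥0∞) * c ∂θ :=
          lintegral_mono fun u => mul_lebesgueNNReal_score_le (m u) (h u) c
      _ = (∫⁻ u, (h u : ℝ≥0∞) ∂θ) * c := lintegral_mul_const _ (by fun_prop)
      _ = c := by
        have := measure_univ (μ := θ.withDensity fun u => (h u : ℝ≥0∞))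
        rw [withDensity_apply _ MeasurableSet.univ, setLIntegral_univ] at this
        rw [this, one_mul]

lemma ae_density_ne_zero (hm : Measurable m) :
    ∀ᵐ u ∂θ.withDensity fun u => (m u : ℝ≥0∞), m u ≠ 0 := by
  rw [ae_withDensity_iff (by fun_prop)]
  exact Filter.Eventually.of_forall fun u hu => by simpa using hu

lemma ae_score_numerator_ne_zero (hm : Measurable m) :
    ∀ᵐ z ∂(θ.withDensity fun u => (m u : ℝ≥0∞)).prod lebesgueNNReal, m z.1 ≠ 0 ∧ z.2 ≠ 0 := by
  have h1 : MeasurableSet {u | m u ≠ 0} := hm (MeasurableSet.singleton 0).compl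
  rw [Measure.ae_prod_iff_ae_ae (by measurability)]
  filter_upwards [ae_density_ne_zero hm] with u hu
  have : ∀ᵐ t : ℝ≥0 ∂lebesgueNNReal, t ≠ 0 := by simp [ae_iff, lebesgueNNReal_singleton]
  filter_upwards [this] with t ht using ⟨hu, ht⟩

/-- Scores are almost surely distinct. -/
lemma measure_score_eq (hm : Measurable m) (hh : Measurable h) {s : ℝ≥0∞} (hs : s ≠ ⊤) :
    ((θ.withDensity fun u => (m u : ℝ≥0∞)).prod lebesgueNNReal)
      {z | score m h z.1 z.2 = s} = 0 := by
  have hms : MeasurableSet {z : 𝒰 × ℝ≥0 | score m h z.1 z.2 = s} :=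
    measurableSet_eq_fun (by fun_prop) measurable_const
  rw [Measure.measure_prod_null hms]
  filter_upwards [ae_density_ne_zero hm] with u hu
  have hsub : (Prod.mk u ⁻¹' {z : 𝒰 × ℝ≥0 | score m h z.1 z.2 = s}).Subsingleton := by
    intro t ht t' ht'
    simp only [Set.mem_preimage, Set.mem_ofPred_eq, score] at ht ht'
    rcases eq_or_ne (h u) 0 with h0 | h0
    · have key : ∀ t : ℝ≥0, (t : ℝ≥0∞) * m u / h u = s → t = 0 := by
        intro t ht
        by_contra ht0
        rw [h0, ENNReal.coe_zero, ENNReal.div_zero (by simp [hu, ht0])] at ht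
        exact hs ht.symm
      rw [key t ht, key t' ht']
    · rw [← ht', ← ENNReal.coe_mul, ← ENNReal.coe_mul, ← ENNReal.coe_div h0, ← ENNReal.coe_div h0,
        ENNReal.coe_inj] at ht
      field_simp at ht
      exact ht
  rcases hsub.eq_empty_or_singleton with h' | ⟨t, h'⟩
  · rw [h']; simp
  · rw [h']; exact lebesgueNNReal_singleton t

lemma ae_eq_zero_of_absolutelyContinuous (hm : Measurable m) (hh : Measurable h)
    (hac : (θ.withDensity fun u => (h u : ℝ≥0∞)) ≪ θ.withDensity fun u => (m u : ℝ≥0∞)) :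
    ∀ᵐ u ∂θ, m u = 0 → h u = 0 := by
  have h1 : ∀ᵐ u ∂θ.withDensity fun u => (h u : ℝ≥0∞), m u ≠ 0 :=
    hac.ae_le (ae_density_ne_zero hm)
  rw [ae_withDensity_iff (by fun_prop)] at h1
  filter_upwards [h1] with u hu h0
  by_contra hne
  exact hu (by simpa using hne) h0

/-- The exponent is linear in `t` with slope `c m / h`, so the integral is `h / (c m)` and the
factor `m` cancels. If `h = 0` the left side vanishes. -/
lemma div_le_lintegral_score {m h : ℝ≥0} (hmh : m = 0 → h = 0) (c G : ℝ≥0∞) :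
    (h : ℝ≥0∞) * (G / c) ≤
      m * (G * ∫⁻ t : ℝ≥0, expNeg (c * (t * m / h)) ∂lebesgueNNReal) := by
  rcases eq_or_ne h 0 with h0 | h0
  · simp [h0]
  have hm0 : m ≠ 0 := fun h' => h0 (hmh h')
  have h1 : ∀ t : ℝ≥0, c * ((t : ℝ≥0∞) * m / h) = c * (m / h) * t := by
    intro t
    rw [mul_div_assoc, mul_comm (t : ℝ≥0∞), mul_assoc]
  simp_rw [h1]
  rw [lintegral_expNeg_mul]
  have hr0 : (m / h : ℝ≥0∞) ≠ 0 := by simp [hm0]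
  have hrt : (m / h : ℝ≥0∞) ≠ ⊤ := ENNReal.div_ne_top (by simp) (by simpa using h0)
  rw [ENNReal.mul_inv (Or.inr hrt) (Or.inr hr0), ENNReal.inv_div (by simp) (by simp [h0])]
  have h2 : (m : ℝ≥0∞) * (h / m) = h :=
    ENNReal.mul_div_cancel (by simpa using hm0) (by simp)
  calc (h : ℝ≥0∞) * (G / c) = (m * (h / m)) * (G / c) := by rw [h2]
    _ ≤ _ := by rw [div_eq_mul_inv G]; apply le_of_eq; ring

/-- The first coordinates of the points, weighted by `e^{-c s}` for a point of score `s`, have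
density `h / c`. -/
lemma lintegral_div_le_lintegral_expNeg (hm : Measurable m) (hh : Measurable h)
    (hac : (θ.withDensity fun u => (h u : ℝ≥0∞)) ≪ θ.withDensity fun u => (m u : ℝ≥0∞))
    {V : Type*} [MeasurableSpace V] (κ : Kernel 𝒰 V) [IsMarkovKernel κ]
    {G c : 𝒰 × V → ℝ≥0∞} (hG : Measurable G) (hc : Measurable c) :
    ∫⁻ u, ∫⁻ v, G (u, v) / c (u, v) ∂κ u ∂(θ.withDensity fun u => (h u : ℝ≥0∞)) ≤
      ∫⁻ z, ∫⁻ v, G (z.1, v) * expNeg (c (z.1, v) * score m h z.1 z.2) ∂κ z.1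
        ∂(θ.withDensity fun u => (m u : ℝ≥0∞)).prod lebesgueNNReal := by
  have he := measurable_expNeg
  have hmeas' : Measurable fun a : (𝒰 × ℝ≥0) × V =>
      G (a.1.1, a.2) * expNeg (c (a.1.1, a.2) * score m h a.1.1 a.1.2) := by
    have : Measurable fun a : (𝒰 × ℝ≥0) × V => score m h a.1.1 a.1.2 := by fun_prop
    fun_prop
  have hmeas : Measurable fun z : 𝒰 × ℝ≥0 =>
      ∫⁻ v, G (z.1, v) * expNeg (c (z.1, v) * score m h z.1 z.2) ∂κ z.1 :=
    hmeas'.lintegral_kernel_prod_right' (κ := κ.comap Prod.fst measurable_fst)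
  have hmeas2 : Measurable fun u => ∫⁻ v, G (u, v) / c (u, v) ∂κ u :=
    (hG.div hc).lintegral_kernel_prod_right'
  rw [lintegral_prod _ hmeas.aemeasurable,
    lintegral_withDensity_eq_lintegral_mul _ (by fun_prop) hmeas2,
    lintegral_withDensity_eq_lintegral_mul _ (by fun_prop) hmeas.lintegral_prod_right']
  refine lintegral_mono_ae ?_
  filter_upwards [ae_eq_zero_of_absolutelyContinuous hm hh hac] with u hu
  simp only [Pi.mul_apply]
  have hsw : Measurable (Function.uncurry fun (t : ℝ≥0) (v : V) =>
      G (u, v) * expNeg (c (u, v) * score m h u t)) :=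
    hmeas'.comp (f := fun a : ℝ≥0 × V => ((u, a.1), a.2))
      ((measurable_const.prodMk measurable_fst).prodMk measurable_snd)
  -- Exchanging `t` and `v` makes the time integral innermost, so the estimate can be applied for
  -- fixed `u` and `v`.
  rw [lintegral_lintegral_swap hsw.aemeasurable, ← lintegral_const_mul _ (by fun_prop),
    ← lintegral_const_mul _ hsw.lintegral_prod_left]
  refine lintegral_mono fun v => ?_
  rw [lintegral_const_mul _ (by fun_prop)]
  exact div_le_lintegral_score hu _ _

/-- Almost every point has nonzero numerator `t m(u)`, so its score is finite only where `h ≠ 0`;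
properties that hold almost everywhere for the density `h` then transfer to the intensity. -/
lemma ae_of_score_lt_top (hm : Measurable m) (hh : Measurable h) {Φ : 𝒰 → Prop}
    (hΦ : ∀ᵐ u ∂(θ.withDensity fun u => (h u : ℝ≥0∞)), Φ u) :
    ∀ᵐ z ∂(θ.withDensity fun u => (m u : ℝ≥0∞)).prod lebesgueNNReal,
      score m h z.1 z.2 < ⊤ → m z.1 ≠ 0 ∧ z.2 ≠ 0 ∧ h z.1 ≠ 0 ∧ Φ z.1 := by
  rw [ae_withDensity_iff (by fun_prop)] at hΦ
  have h1 : ∀ᵐ u ∂θ.withDensity fun u => (m u : ℝ≥0∞), (h u : ℝ≥0∞) ≠ 0 → Φ u :=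
    (withDensity_absolutelyContinuous θ _).ae_le hΦ
  filter_upwards [ae_score_numerator_ne_zero hm, Measure.quasiMeasurePreserving_fst.ae h1]
    with z hz hz' hlt
  have h0 : h z.1 ≠ 0 := by
    intro h0
    rw [score, h0, ENNReal.coe_zero, ENNReal.div_zero (by simp [hz.1, hz.2])] at hlt
    exact lt_irrefl _ hlt
  exact ⟨hz.1, hz.2, h0, hz' (by simpa using h0)⟩

/-- Changing the density multiplies the score by the ratio of the densities. -/
lemma score_eq_ratio_mul {m f g : 𝒰 → ℝ≥0} {u : 𝒰} {t : ℝ≥0}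
    (hf : f u ≠ 0) : score m g u t = ratio (f u) (g u) * score m f u t := by
  have h1 : (f u : ℝ≥0∞) ≠ 0 := by simpa using hf
  have h2 : (f u : ℝ≥0∞) * ((t * m u) / f u) = t * m u := ENNReal.mul_div_cancel h1 (by simp)
  rw [score, score, ratio, ENNReal.div_eq_inv_mul (a := (f u : ℝ≥0∞)), mul_assoc, h2,
    ENNReal.div_eq_inv_mul]

end Intensity

/-! ### Minimizers and measurability of `argmin` -/

section Minimizer

/-- `i` is the only minimizer of `s` over `S`. -/
def IsStrictMin (S : Set ℕ) (s : ℕ → ℝ≥0∞) (i : ℕ) : Prop :=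
  i ∈ S ∧ ∀ k ∈ S, k ≠ i → s i < s k

variable {S : Set ℕ} {s : ℕ → ℝ≥0∞} {i : ℕ}

lemma IsStrictMin.isMinimizer_iff (h : IsStrictMin S s i) (k : ℕ) :
    IsMinimizer S s k ↔ k = i := by
  constructor
  · intro hk
    by_contra hne
    exact (h.2 k hk.1 hne).not_ge (hk.2 i h.1)
  · rintro rfl
    refine ⟨h.1, fun j hj => ?_⟩
    rcases eq_or_ne j k with rfl | hne
    · exact le_rfl
    · exact (h.2 j hj hne).le

lemma IsStrictMin.existsUnique (h : IsStrictMin S s i) : ∃! k, IsMinimizer S s k :=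
  ⟨i, (h.isMinimizer_iff i).2 rfl, fun k hk => (h.isMinimizer_iff k).1 hk⟩

lemma IsStrictMin.argmin_eq (h : IsStrictMin S s i) : argmin S s = i := by
  have : {k | IsMinimizer S s k} = {i} := by
    ext k; exact h.isMinimizer_iff k
  rw [argmin, this, csInf_singleton]

lemma IsStrictMin.unique {k : ℕ} (h : IsStrictMin S s i) (hk : IsStrictMin S s k) : i = k :=
  h.argmin_eq.symm.trans hk.argmin_eq

variable {α : Type*} [MeasurableSpace α]

lemma measurableSet_isMinimizer {S : α → Set ℕ} {s : α → ℕ → ℝ≥0∞}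
    (hS : ∀ i, MeasurableSet {a | i ∈ S a}) (hs : ∀ i, Measurable fun a => s a i) (i : ℕ) :
    MeasurableSet {a | IsMinimizer (S a) (s a) i} := by
  have : {a | IsMinimizer (S a) (s a) i} =
      {a | i ∈ S a} ∩ ⋂ j, ({a | j ∈ S a}ᶜ ∪ {a | s a i ≤ s a j}) := by
    ext a
    simp only [IsMinimizer, Set.mem_ofPred_eq, Set.mem_inter_iff, Set.mem_iInter, Set.mem_union,
      Set.mem_compl_iff, imp_iff_not_or]
  rw [this]
  exact (hS i).inter (MeasurableSet.iInter fun j =>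
    (hS j).compl.union (measurableSet_le (hs i) (hs j)))

lemma measurableSet_isStrictMin {S : α → Set ℕ} {s : α → ℕ → ℝ≥0∞}
    (hS : ∀ i, MeasurableSet {a | i ∈ S a}) (hs : ∀ i, Measurable fun a => s a i) (i : ℕ) :
    MeasurableSet {a | IsStrictMin (S a) (s a) i} := by
  have : {a | IsStrictMin (S a) (s a) i} =
      {a | i ∈ S a} ∩ ⋂ j, ⋂ (_ : j ≠ i), ({a | j ∈ S a}ᶜ ∪ {a | s a i < s a j}) := by
    ext a
    simp only [IsStrictMin, Set.mem_ofPred_eq, Set.mem_inter_iff, Set.mem_iInter, Set.mem_union,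
      Set.mem_compl_iff]
    constructor
    · exact fun h => ⟨h.1, fun j hj => imp_iff_not_or.1 fun hjS => h.2 j hjS hj⟩
    · exact fun h => ⟨h.1, fun j hjS hj => (h.2 j hj).resolve_left fun h' => h' hjS⟩
  rw [this]
  exact (hS i).inter (MeasurableSet.iInter fun j => MeasurableSet.iInter fun _ =>
    (hS j).compl.union (measurableSet_lt (hs i) (hs j)))

lemma measurableSet_exists_isStrictMin {S : α → Set ℕ} {s : α → ℕ → ℝ≥0∞}
    (hS : ∀ i, MeasurableSet {a | i ∈ S a}) (hs : ∀ i, Measurable fun a => s a i) :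
    MeasurableSet {a | ∃ i, IsStrictMin (S a) (s a) i} := by
  rw [Set.ofPred_exists]
  exact MeasurableSet.iUnion (measurableSet_isStrictMin hS hs)

lemma measurable_argmin {S : α → Set ℕ} {s : α → ℕ → ℝ≥0∞}
    (hS : ∀ i, MeasurableSet {a | i ∈ S a}) (hs : ∀ i, Measurable fun a => s a i) :
    Measurable fun a => argmin (S a) (s a) := by
  classical
  have h1 := measurableSet_isMinimizer hS hs
  have hex : MeasurableSet {a | ∃ i, IsMinimizer (S a) (s a) i} := by
    rw [Set.ofPred_exists]
    exact MeasurableSet.iUnion h1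
  -- Since `sInf ∅ = 0` in `ℕ`, admitting every index when there is no minimizer leaves the value
  -- unchanged and makes the set nonempty, as `Nat.find` requires.
  have h0 : ∀ a, argmin (S a) (s a) =
      sInf {i | IsMinimizer (S a) (s a) i ∨ ¬ ∃ i, IsMinimizer (S a) (s a) i} := by
    intro a
    rw [argmin]
    by_cases h : ∃ i, IsMinimizer (S a) (s a) i
    · congr 1; ext i; simp [h]
    · have e1 : {i | IsMinimizer (S a) (s a) i} = ∅ := by
        ext i; simp only [Set.mem_ofPred_eq, Set.mem_empty_iff_false, iff_false]
        exact fun hi => h ⟨i, hi⟩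
      have e2 : {i | IsMinimizer (S a) (s a) i ∨ ¬ ∃ i, IsMinimizer (S a) (s a) i} =
          Set.univ := by
        ext i; simp [h]
      rw [e1, e2]; simp
  have hne : ∀ a, ∃ i, IsMinimizer (S a) (s a) i ∨ ¬ ∃ i, IsMinimizer (S a) (s a) i := by
    intro a
    by_cases h : ∃ i, IsMinimizer (S a) (s a) i
    · exact h.imp fun i hi => Or.inl hi
    · exact ⟨0, Or.inr h⟩
  have h2 : (fun a => argmin (S a) (s a)) = fun a => @Nat.find (fun i =>
      i ∈ {i | IsMinimizer (S a) (s a) i ∨ ¬ ∃ i, IsMinimizer (S a) (s a) i})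
      (fun _ => Classical.propDecidable _) (hne a) := by
    ext a
    rw [h0 a]
    exact Nat.sInf_def (hne a)
  rw [h2]
  exact @measurable_find _ _ (fun a i =>
    i ∈ {i | IsMinimizer (S a) (s a) i ∨ ¬ ∃ i, IsMinimizer (S a) (s a) i})
    (fun _ _ => Classical.propDecidable _) hne fun i => (h1 i).union hex.compl

lemma measurable_eval_nat {β : Type*} [MeasurableSpace β] {f : ℕ → α → β}
    (hf : ∀ i, Measurable (f i)) {n : α → ℕ} (hn : Measurable n) :
    Measurable fun a => f (n a) a := by
  have : Measurable fun x : ℕ × α => f x.1 x.2 := measurable_from_prod_countable_right hf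
  exact this.comp (hn.prodMk measurable_id)

end Minimizer

/-! ### Strict minimizers with a given label -/

section Labels

variable {Ω : Type*} [MeasurableSpace Ω] {Pr : Measure Ω} {J : ℕ} {Z : ℕ → Ω → Fin J}

/-- A lower bound on the probability that, among the indices in `I`, there is a unique minimizer
of `s` with label `j`. -/
lemma tsum_inv_mul_thin_le [IsProbabilityMeasure Pr]
    (hZm : ∀ i, Measurable (Z i)) (hZ : ∀ i, HasLaw (Z i) (uniformOn Set.univ) Pr)
    (hZi : iIndepFun Z Pr) (j : Fin J) (I : Set ℕ) (s : ℕ → ℝ≥0∞) :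
    ∑' i, ({i | i ∈ I ∧ s i < ⊤}).indicator (fun i => (J : ℝ≥0∞)⁻¹ *
        thin J (∑' k, {k | k ∈ I ∧ k ≠ i ∧ s k ≤ s i}.indicator 1 k)) i ≤
      Pr {ω | ∃ i, s i < ⊤ ∧ IsStrictMin (I ∩ {k | Z k ω = j}) s i} := by
  have hS : ∀ k, MeasurableSet {ω | k ∈ I ∩ {k | Z k ω = j}} := fun k =>
    (MeasurableSet.const (k ∈ I)).inter (hZm k (MeasurableSet.singleton j))
  have hU : {ω | ∃ i, s i < ⊤ ∧ IsStrictMin (I ∩ {k | Z k ω = j}) s i} =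
      ⋃ i, {ω | s i < ⊤ ∧ IsStrictMin (I ∩ {k | Z k ω = j}) s i} := by
    ext ω; simp
  -- A strict minimizer is unique, so the events indexed by `i` are disjoint and their probabilities
  -- add.
  rw [hU, measure_iUnion]
  · refine ENNReal.tsum_le_tsum fun i => ?_
    by_cases hi : i ∈ {i | i ∈ I ∧ s i < ⊤}
    swap
    · rw [Set.indicator_of_notMem hi]; exact zero_le
    rw [Set.indicator_of_mem hi]
    refine (inv_mul_thin_le_measure_labels hZm hZ hZi i j
      (I := {k | k ∈ I ∧ k ≠ i ∧ s k ≤ s i}) (by simp)).trans (measure_mono fun ω hω => ?_)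
    refine ⟨hi.2, ⟨hi.1, hω.1⟩, fun k hk hki => ?_⟩
    by_contra hlt
    exact hω.2 k ⟨hk.1, hki, not_lt.1 hlt⟩ hk.2
  · intro a b hab
    refine Set.disjoint_left.2 fun ω ha hb => hab (ha.2.unique hb.2)
  · intro i
    change MeasurableSet ({ω | s i < ⊤} ∩ {ω | IsStrictMin (I ∩ {k | Z k ω = j}) s i})
    exact (MeasurableSet.const _).inter
      (measurableSet_isStrictMin (s := fun _ => s) hS (fun _ => measurable_const) i)

end Labels

/-! ### The process with one point removed -/

section Deleted

variable {Ω E : Type*} [MeasurableSpace Ω] [MeasurableSpace E]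

lemma deletedMeasure_eq_zero_iff (ξ : ℕ → Ω → E) (i : ℕ) (ω : Ω) {A : Set E}
    (hA : MeasurableSet A) :
    deletedMeasure ξ i ω A = 0 ↔ ∀ k, k ≠ i → ξ k ω ∉ A := by
  rw [deletedMeasure_apply ξ i ω hA, ENNReal.tsum_eq_zero]
  refine forall_congr' fun k => ?_
  by_cases hk : k = i <;> simp [hk]

lemma deletedMeasure_apply_eq_tsum (ξ : ℕ → Ω → E) (i : ℕ) (ω : Ω) {A : Set E}
    (hA : MeasurableSet A) :
    deletedMeasure ξ i ω A = ∑' k, {k | k ≠ i ∧ ξ k ω ∈ A}.indicator 1 k := by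
  rw [deletedMeasure_apply ξ i ω hA]
  refine tsum_congr fun k => ?_
  by_cases hk : k = i
  · rw [if_pos hk, Set.indicator_of_notMem (s := {k | k ≠ i ∧ ξ k ω ∈ A}) fun h => h.1 hk]
  · rw [if_neg hk]
    by_cases hkA : ξ k ω ∈ A
    · rw [Set.indicator_of_mem hkA, Set.indicator_of_mem (show k ∈ {k | k ≠ i ∧ ξ k ω ∈ A} from ⟨hk, hkA⟩)]; rfl
    · rw [Set.indicator_of_notMem hkA, Set.indicator_of_notMem (s := {k | k ≠ i ∧ ξ k ω ∈ A}) fun h => hkA h.2]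

variable {A : Type*} [MeasurableSpace A] {ν : Measure E} [SigmaFinite ν]

/-- The reason for `locFin`: joint measurability of `N`-measures of parametrized sections needs an
s-finite kernel. -/
lemma measurable_locFin_preimage {g : A → Measure E} (hg : Measurable g) {t : Set (A × E)}
    (ht : MeasurableSet t) : Measurable fun a => locFin ν (g a) (Prod.mk a ⁻¹' t) :=
  Kernel.measurable_kernel_prodMk_left (κ := (locFin ν).comap g hg) ht

lemma measurable_lintegral_locFin {g : A → Measure E} (hg : Measurable g) {f : A × E → ℝ≥0∞}
    (hf : Measurable f) : Measurable fun a => ∫⁻ z, f (a, z) ∂locFin ν (g a) :=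
  hf.lintegral_kernel_prod_right' (κ := (locFin ν).comap g hg)

end Deleted

/-! ### The labelled codebook and the general Palm bound -/

section Codebook

variable {Ω 𝒳 𝒰 V : Type*} [MeasurableSpace Ω] [MeasurableSpace 𝒳] [MeasurableSpace 𝒰]
  [MeasurableSpace V] {J : ℕ}

/-- The points `ξ` of a Poisson process with i.i.d. uniform labels `Z`, and an independent
input `X` with law `PX`. -/
structure IsCodebook (ξ : ℕ → Ω → 𝒰 × ℝ≥0) (Z : ℕ → Ω → Fin J) (X : Ω → 𝒳)
    (ν : Measure (𝒰 × ℝ≥0)) (PX : Measure 𝒳) (Pr : Measure Ω) : Prop where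
  poisson : IsPoissonProcess ξ ν Pr
  measurable_label : ∀ i, Measurable (Z i)
  hasLaw_label : ∀ i, HasLaw (Z i) (uniformOn Set.univ) Pr
  indep_label : iIndepFun Z Pr
  indep_label_points : IndepFun (fun ω i => Z i ω) (fun ω i => ξ i ω) Pr
  measurable_input : Measurable X
  hasLaw_input : HasLaw X PX Pr
  indep_input : IndepFun X (fun ω => ((fun i => ξ i ω), fun i => Z i ω)) Pr

variable {ξ : ℕ → Ω → 𝒰 × ℝ≥0} {Z : ℕ → Ω → Fin J} {X : Ω → 𝒳}
    {ν : Measure (𝒰 × ℝ≥0)} {PX : Measure 𝒳} {Pr : Measure Ω} [IsProbabilityMeasure Pr]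

lemma IsCodebook.measurable_points (h : IsCodebook ξ Z X ν PX Pr) :
    Measurable fun ω i => ξ i ω := measurable_pi_iff.2 h.poisson.measurable

lemma IsCodebook.measurable_labels (h : IsCodebook ξ Z X ν PX Pr) :
    Measurable fun ω i => Z i ω := measurable_pi_iff.2 h.measurable_label

/-- The input, the points and the labels are independent, so the labels may be resampled on a
separate copy `ω'` of the space with the points held fixed. -/
lemma IsCodebook.lintegral_eq (h : IsCodebook ξ Z X ν PX Pr)
    {F : 𝒳 × ((ℕ → 𝒰 × ℝ≥0) × (ℕ → Fin J)) → ℝ≥0∞} (hF : Measurable F) :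
    ∫⁻ ω, F (X ω, ((fun i => ξ i ω), fun i => Z i ω)) ∂Pr =
      ∫⁻ x, ∫⁻ ω, ∫⁻ ω', F (x, ((fun i => ξ i ω), fun i => Z i ω')) ∂Pr ∂Pr ∂PX := by
  have hξ := h.measurable_points
  have hZ := h.measurable_labels
  have hX := h.measurable_input
  have h1 := (indepFun_iff_map_prod_eq_prod_map_map hX.aemeasurable
    (hξ.prodMk hZ).aemeasurable).1 h.indep_input
  have h2 := (indepFun_iff_map_prod_eq_prod_map_map hξ.aemeasurable hZ.aemeasurable).1
    h.indep_label_points.symm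
  have i1 : IsProbabilityMeasure (Pr.map fun ω i => ξ i ω) :=
    Measure.isProbabilityMeasure_map hξ.aemeasurable
  have i2 : IsProbabilityMeasure (Pr.map fun ω i => Z i ω) :=
    Measure.isProbabilityMeasure_map hZ.aemeasurable
  rw [h.hasLaw_input.map_eq] at h1
  rw [← lintegral_map (g := fun ω => (X ω, ((fun i => ξ i ω), fun i => Z i ω))) hF
    (hX.prodMk (hξ.prodMk hZ)), h1, h2, lintegral_prod _ hF.aemeasurable]
  refine lintegral_congr fun x => ?_
  have hFx : Measurable fun a => F (x, a) := hF.comp measurable_prodMk_left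
  rw [lintegral_prod _ hFx.aemeasurable, lintegral_map hFx.lintegral_prod_right' hξ]
  refine lintegral_congr fun ω => ?_
  have hFω : Measurable fun z : ℕ → Fin J => F (x, ((fun i => ξ i ω), z)) :=
    hFx.comp measurable_prodMk_left
  rw [lintegral_map hFω hZ]

variable {κ : Kernel (𝒳 × 𝒰) V} [IsMarkovKernel κ] {Yv : Ω → V}
  {u : 𝒳 × (ℕ → 𝒰 × ℝ≥0) → 𝒰}

/-- Given the input, points and labels, the law of `Yv` depends only on `x` and the selected `u`;
disintegrate along it and then use independence. -/
lemma IsCodebook.measure_eq (h : IsCodebook ξ Z X ν PX Pr) (hu : Measurable u)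
    (hY : HasCondDistrib Yv
      (fun ω => ((X ω, u (X ω, fun i => ξ i ω)), ((fun i => ξ i ω), fun i => Z i ω)))
      (κ.prodMkRight ((ℕ → 𝒰 × ℝ≥0) × (ℕ → Fin J))) Pr)
    {B : Set ((𝒳 × ((ℕ → 𝒰 × ℝ≥0) × (ℕ → Fin J))) × V)} (hB : MeasurableSet B) :
    Pr {ω | ((X ω, ((fun i => ξ i ω), fun i => Z i ω)), Yv ω) ∈ B} =
      ∫⁻ x, ∫⁻ ω, ∫⁻ ω', κ (x, u (x, fun i => ξ i ω))
        {v | ((x, ((fun i => ξ i ω), fun i => Z i ω')), v) ∈ B} ∂Pr ∂Pr ∂PX := by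
  have hξ := h.measurable_points
  have hZ := h.measurable_labels
  have hX := h.measurable_input
  have hg : Measurable fun a : ((𝒳 × 𝒰) × ((ℕ → 𝒰 × ℝ≥0) × (ℕ → Fin J))) × V =>
      ((a.1.1.1, a.1.2), a.2) := by fun_prop
  have hL : Measurable fun ω =>
      ((X ω, u (X ω, fun i => ξ i ω)), ((fun i => ξ i ω), fun i => Z i ω)) :=
    (hX.prodMk (hu.comp (hX.prodMk hξ))).prodMk (hξ.prodMk hZ)
  have h1 := HasLaw.measure_eq hY (p := fun a => ((a.1.1.1, a.1.2), a.2) ∈ B) (hg hB)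
  refine h1.trans ?_
  have : IsProbabilityMeasure (Pr.map fun ω =>
      ((X ω, u (X ω, fun i => ξ i ω)), ((fun i => ξ i ω), fun i => Z i ω))) :=
    Measure.isProbabilityMeasure_map hL.aemeasurable
  refine (Measure.compProd_apply (hg hB)).trans ?_
  rw [lintegral_map (Kernel.measurable_kernel_prodMk_left (hg hB)) hL]
  have hF : Measurable fun a : 𝒳 × ((ℕ → 𝒰 × ℝ≥0) × (ℕ → Fin J)) =>
      κ (a.1, u (a.1, a.2.1)) {v | (a, v) ∈ B} :=
    Kernel.measurable_kernel_prodMk_left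
      (κ := κ.comap (fun a : 𝒳 × ((ℕ → 𝒰 × ℝ≥0) × (ℕ → Fin J)) => (a.1, u (a.1, a.2.1)))
        (by fun_prop)) hB
  exact h.lintegral_eq hF

/-- A lower bound for the probability of an event that may depend on the point `u` with the least
score, in terms of the reduced Palm version of the process. -/
theorem IsCodebook.le_measure [SigmaFinite ν] (h : IsCodebook ξ Z X ν PX Pr) (hu : Measurable u)
    {f : 𝒳 → 𝒰 × ℝ≥0 → ℝ≥0∞} (hf : Measurable (Function.uncurry f))
    (huf : ∀ x e i, IsStrictMin Set.univ (fun k => f x (e k)) i → u (x, e) = (e i).1)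
    (hY : HasCondDistrib Yv
      (fun ω => ((X ω, u (X ω, fun i => ξ i ω)), ((fun i => ξ i ω), fun i => Z i ω)))
      (κ.prodMkRight ((ℕ → 𝒰 × ℝ≥0) × (ℕ → Fin J))) Pr)
    {B : Set ((𝒳 × ((ℕ → 𝒰 × ℝ≥0) × (ℕ → Fin J))) × V)} (hB : MeasurableSet B)
    {Λ : 𝒳 → ((𝒰 × ℝ≥0) × Measure (𝒰 × ℝ≥0)) × V → ℝ≥0∞} (hΛm : ∀ x, Measurable (Λ x))
    (hΛ : ∀ x, ∀ᵐ ω ∂Pr, ∀ i, IsStrictMin Set.univ (fun k => f x (ξ k ω)) i → ∀ v,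
      Λ x ((ξ i ω, deletedMeasure ξ i ω), v) ≤
        Pr {ω' | ((x, ((fun k => ξ k ω), fun k => Z k ω')), v) ∈ B}) :
    ∫⁻ x, ∫⁻ z, {z | f x z < ⊤}.indicator (fun z => ∫⁻ v, ∫⁻ ω,
        isZero (pointMeasure ξ ω {y | f x y ≤ f x z}) * Λ x ((z, pointMeasure ξ ω), v) ∂Pr
          ∂κ (x, z.1)) z ∂ν ∂PX ≤
      Pr {ω | ((X ω, ((fun k => ξ k ω), fun k => Z k ω)), Yv ω) ∈ B} := by
  classical
  rw [h.measure_eq hu hY hB]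
  refine lintegral_mono fun x => ?_
  have hfx : Measurable (f x) := hf.comp measurable_prodMk_left
  have hZm := h.measurable_labels
  have hξm := h.poisson.measurable
  have hsub : ∀ z, MeasurableSet {y | f x y ≤ f x z} := fun z =>
    measurableSet_le hfx measurable_const
  let I : (𝒰 × ℝ≥0) × Measure (𝒰 × ℝ≥0) → ℝ≥0∞ := fun a => ∫⁻ v, Λ x (a, v) ∂κ (x, a.1.1)
  have hI : Measurable I := (hΛm x).lintegral_kernel_prod_right'
    (κ := κ.comap (fun a : (𝒰 × ℝ≥0) × Measure (𝒰 × ℝ≥0) => (x, a.1.1)) (by fun_prop))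
  -- The summand for the Mecke formula: the point has finite score, no remaining point scores at
  -- most as much, and the weight is `Λ` averaged over `v`.
  let F : (𝒰 × ℝ≥0) × Measure (𝒰 × ℝ≥0) → ℝ≥0∞ := fun a =>
    if f x a.1 < ⊤ then isZero (locFin ν a.2 {y | f x y ≤ f x a.1}) * I a else 0
  have hR : Measurable fun a : (𝒰 × ℝ≥0) × Measure (𝒰 × ℝ≥0) =>
      locFin ν a.2 {y | f x y ≤ f x a.1} :=
    measurable_locFin_preimage measurable_snd
      (t := {b : ((𝒰 × ℝ≥0) × Measure (𝒰 × ℝ≥0)) × (𝒰 × ℝ≥0) | f x b.2 ≤ f x b.1.1})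
      (measurableSet_le (by fun_prop) (by fun_prop))
  have hF : Measurable F :=
    Measurable.ite (measurableSet_lt (hfx.comp measurable_fst) measurable_const)
      ((measurable_isZero.comp hR).mul hI) measurable_const
  have hFi : ∀ i, Measurable fun ω => F (ξ i ω, deletedMeasure ξ i ω) := fun i =>
    hF.comp ((hξm i).prodMk (measurable_deletedMeasure hξm i))
  have hle : ∀ᵐ ω ∂Pr, ∑' i, F (ξ i ω, deletedMeasure ξ i ω) ≤
      ∫⁻ ω', κ (x, u (x, fun i => ξ i ω))
        {v | ((x, ((fun i => ξ i ω), fun i => Z i ω')), v) ∈ B} ∂Pr := by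
    filter_upwards [h.poisson.ae_locFin_eq, hΛ x] with ω hω hω'
    have hstrict : ∀ i, F (ξ i ω, deletedMeasure ξ i ω) ≠ 0 →
        IsStrictMin Set.univ (fun k => f x (ξ k ω)) i := by
      intro i hi
      simp only [F, hω.1 i] at hi
      split_ifs at hi with hlt
      · have h0 : deletedMeasure ξ i ω {y | f x y ≤ f x (ξ i ω)} = 0 := by
          by_contra hne
          exact hi (by rw [isZero_of_ne hne, zero_mul])
        rw [deletedMeasure_eq_zero_iff ξ i ω (hsub _)] at h0
        exact ⟨trivial, fun k _ hk => not_le.1 (h0 k hk)⟩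
      · exact absurd rfl hi
    -- A nonzero summand forces a strict minimizer, so the sum has at most one nonzero term, at the
    -- point the encoder selects.
    by_cases hex : ∃ i, F (ξ i ω, deletedMeasure ξ i ω) ≠ 0
    · obtain ⟨i, hi⟩ := hex
      have hs := hstrict i hi
      rw [tsum_eq_single i fun k hk => by
        by_contra hne
        exact hk ((hstrict k hne).unique hs)]
      rw [huf x (fun k => ξ k ω) i hs]
      have hm : Measurable fun a : Ω × V =>
          ((x, ((fun k => ξ k ω), fun k => Z k a.1)), a.2) :=
        (measurable_const.prodMk
          (measurable_const.prodMk (hZm.comp measurable_fst))).prodMk measurable_snd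
      have e1 := Measure.prod_apply (μ := Pr) (ν := κ (x, (ξ i ω).1)) (hm hB)
      have e2 := Measure.prod_apply_symm (μ := Pr) (ν := κ (x, (ξ i ω).1)) (hm hB)
      calc F (ξ i ω, deletedMeasure ξ i ω) ≤ I (ξ i ω, deletedMeasure ξ i ω) := by
            simp only [F]
            split_ifs
            · refine mul_le_of_le_one_left' ?_
              exact Set.indicator_le_self' (fun _ _ => zero_le) _
            · exact zero_le
        _ ≤ ∫⁻ v, Pr {ω' | ((x, ((fun k => ξ k ω), fun k => Z k ω')), v) ∈ B}
              ∂κ (x, (ξ i ω).1) := lintegral_mono fun v => hω' i hs v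
        _ = _ := e2.symm.trans e1
    · push Not at hex
      simp [hex]
  refine le_trans ?_ (lintegral_mono_ae hle)
  rw [lintegral_tsum fun i => (hFi i).aemeasurable, h.poisson.mecke hF]
  refine lintegral_mono fun z => ?_
  by_cases hz : f x z < ⊤
  swap
  · rw [Set.indicator_of_notMem (show z ∉ {z | f x z < ⊤} from hz)]; exact zero_le
  rw [Set.indicator_of_mem (show z ∈ {z | f x z < ⊤} from hz)]
  have hN := measurable_pointMeasure hξm
  have hNz : Measurable fun ω => isZero (pointMeasure ξ ω {y | f x y ≤ f x z}) :=
    measurable_isZero.comp ((Measure.measurable_coe (hsub z)).comp hN)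
  have hsw : Measurable (Function.uncurry fun (v : V) (ω : Ω) =>
      isZero (pointMeasure ξ ω {y | f x y ≤ f x z}) * Λ x ((z, pointMeasure ξ ω), v)) :=
    (hNz.comp measurable_snd).mul ((hΛm x).comp
      ((measurable_const.prodMk (hN.comp measurable_snd)).prodMk measurable_fst))
  rw [lintegral_lintegral_swap hsw.aemeasurable]
  refine lintegral_mono_ae ?_
  filter_upwards [h.poisson.ae_locFin_eq] with ω hω
  simp only [F, hz, if_true, hω.2, I]
  have hΛω : Measurable fun v => Λ x ((z, pointMeasure ξ ω), v) :=
    (hΛm x).comp measurable_prodMk_left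
  rw [lintegral_const_mul _ hΛω]

end Codebook

lemma measurable_score_comp {α β 𝒰 : Type*} [MeasurableSpace α] [MeasurableSpace β]
    [MeasurableSpace 𝒰] {m : 𝒰 → ℝ≥0} {q : β → 𝒰 → ℝ≥0}
    (hm : Measurable m) (hq : Measurable (Function.uncurry q)) {y : α → β} (hy : Measurable y)
    {u : α → 𝒰} (hu : Measurable u) {t : α → ℝ≥0} (ht : Measurable t) :
    Measurable fun a => score m (q (y a)) (u a) (t a) :=
  measurable_score (h := fun a => q (y a)) hm
    (hq.comp ((hy.comp measurable_fst).prodMk measurable_snd)) hu ht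

lemma tsum_indicator_sub_one {T : Set ℕ} {k : ℕ} (hk : k ∈ T) :
    (∑' l, T.indicator (1 : ℕ → ℝ≥0∞) l) - 1 = ∑' l, (T \ {k}).indicator 1 l := by
  rw [ENNReal.tsum_eq_add_tsum_ite k, Set.indicator_of_mem hk, Pi.one_apply,
    ENNReal.add_sub_cancel_left (by simp)]
  refine tsum_congr fun l => ?_
  by_cases hl : l = k
  · subst hl; simp
  · by_cases hT : l ∈ T <;> simp [hl, hT]

/-- Adding one index whose value is not a tie preserves uniqueness of the minimizer. -/
lemma exists_isStrictMin_of_compl {S : Set ℕ} {s : ℕ → ℝ≥0∞} {i k : ℕ} (hk : s k < ⊤)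
    (hS : IsStrictMin ({i}ᶜ ∩ S) s k) (hi : ∀ l, l ≠ i → ¬ (s l = s i ∧ s l < ⊤)) :
    ∃ k, IsStrictMin S s k := by
  have hki : k ≠ i := hS.1.1
  by_cases hiS : i ∈ S
  · rcases lt_trichotomy (s k) (s i) with h | h | h
    · refine ⟨k, hS.1.2, fun l hl hlk => ?_⟩
      by_cases hli : l = i
      · rwa [hli]
      · exact hS.2 l ⟨hli, hl⟩ hlk
    · exact absurd ⟨h, hk⟩ (hi k hki)
    · refine ⟨i, hiS, fun l hl hli => ?_⟩
      by_cases hlk : l = k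
      · rwa [hlk]
      · exact h.trans (hS.2 l ⟨hli, hl⟩ hlk)
  · refine ⟨k, hS.1.2, fun l hl hlk => hS.2 l ⟨fun hli => hiS ?_, hl⟩ hlk⟩
    rwa [← Set.mem_singleton_iff.1 hli]

/-! ### Existence of a minimizer with a given label -/

section Poisson

variable {Ω 𝒳 𝒰 V : Type*} [MeasurableSpace Ω] [MeasurableSpace 𝒳] [MeasurableSpace 𝒰]
  [MeasurableSpace V] {J : ℕ} {θ : Measure 𝒰} [SigmaFinite θ] {m : 𝒰 → ℝ≥0}
  {Pr : Measure Ω} [IsProbabilityMeasure Pr]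
  {ξ : ℕ → Ω → 𝒰 × ℝ≥0} {Z : ℕ → Ω → Fin J}

/-- The probability that a labelled point with label `j` is the unique minimizer of `g` among
those with this label, summed over the points of `N`. -/
noncomputable def labelledMinProb (J : ℕ) {E : Type*} [MeasurableSpace E] (g : E → ℝ≥0∞)
    (N : Measure E) : ℝ≥0∞ :=
  ∫⁻ z, {z | g z < ⊤}.indicator (fun z => (J : ℝ≥0∞)⁻¹ * thin J (N {y | g y ≤ g z} - 1)) z ∂N

/-- The mass of a sublevel set is monotone in the level, so no finiteness of `N` is needed. -/
lemma measurable_labelledMinProb_integrand {E : Type*} [MeasurableSpace E] {g : E → ℝ≥0∞}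
    (hg : Measurable g) (N : Measure E) :
    Measurable ({z | g z < ⊤}.indicator
      (fun z => (J : ℝ≥0∞)⁻¹ * thin J (N {y | g y ≤ g z} - 1))) := by
  have h1 : Measurable fun c : ℝ≥0∞ => N {y | g y ≤ c} :=
    Monotone.measurable fun a b hab => measure_mono fun y hy => le_trans hy hab
  have h2 := measurable_thin J
  exact Measurable.indicator (((h2.comp ((h1.comp hg).sub_const 1))).const_mul _)
    (measurableSet_lt hg measurable_const)

/-- With the points fixed, each `k ≠ i` contributes the probability that it alone has label `j`
among the remaining points scoring no more; the `- 1` in `labelledMinProb` discounts `k` itself. -/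
lemma labelledMinProb_deletedMeasure_le {E : Type*} [MeasurableSpace E] {ξ : ℕ → Ω → E}
    (hZm : ∀ i, Measurable (Z i)) (hZ : ∀ i, HasLaw (Z i) (uniformOn Set.univ) Pr)
    (hZi : iIndepFun Z Pr) (j : Fin J) {g : E → ℝ≥0∞} (hg : Measurable g) (i : ℕ) (ω : Ω) :
    labelledMinProb J g (deletedMeasure ξ i ω) ≤
      Pr {ω' | ∃ k, g (ξ k ω) < ⊤ ∧
        IsStrictMin ({i}ᶜ ∩ {k | Z k ω' = j}) (fun k => g (ξ k ω)) k} := by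
  refine le_trans (le_of_eq ?_)
    (tsum_inv_mul_thin_le hZm hZ hZi j {i}ᶜ fun k => g (ξ k ω))
  rw [labelledMinProb,
    lintegral_deletedMeasure ξ i ω (measurable_labelledMinProb_integrand hg _)]
  refine tsum_congr fun k => ?_
  by_cases hk : k = i
  · rw [if_pos hk, Set.indicator_of_notMem]
    exact fun h => h.1 hk
  rw [if_neg hk]
  by_cases hgk : g (ξ k ω) < ⊤
  · rw [Set.indicator_of_mem (show ξ k ω ∈ {z | g z < ⊤} from hgk),
      Set.indicator_of_mem (show k ∈ {k | k ∈ ({i}ᶜ : Set ℕ) ∧ g (ξ k ω) < ⊤} from ⟨hk, hgk⟩),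
      deletedMeasure_apply_eq_tsum ξ i ω (measurableSet_le hg measurable_const),
      tsum_indicator_sub_one (T := {l | l ≠ i ∧ ξ l ω ∈ {y | g y ≤ g (ξ k ω)}}) (k := k)
        ⟨hk, le_refl (g (ξ k ω))⟩]
    congr 4
    ext l
    congr 1
    ext l
    simp only [Set.mem_sdiff, Set.mem_ofPred_eq, Set.mem_singleton_iff, Set.mem_compl_iff]
    tauto
  · rw [Set.indicator_of_notMem (show ξ k ω ∉ {z | g z < ⊤} from hgk),
      Set.indicator_of_notMem fun h => hgk h.2]

lemma labelledMinProb_pointMeasure {E : Type*} [MeasurableSpace E] {ξ : ℕ → Ω → E}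
    {g : E → ℝ≥0∞} (hg : Measurable g) (ω : Ω) :
    labelledMinProb J g (pointMeasure ξ ω) = ∑' k, {z | g z < ⊤}.indicator
      (fun z => (J : ℝ≥0∞)⁻¹ * thin J (deletedMeasure ξ k ω {y | g y ≤ g z})) (ξ k ω) := by
  rw [labelledMinProb, lintegral_pointMeasure ξ ω (measurable_labelledMinProb_integrand hg _)]
  refine tsum_congr fun k => ?_
  by_cases hgk : g (ξ k ω) < ⊤
  · rw [Set.indicator_of_mem (show ξ k ω ∈ {z | g z < ⊤} from hgk),
      Set.indicator_of_mem (show ξ k ω ∈ {z | g z < ⊤} from hgk),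
      pointMeasure_apply_eq_add ξ k ω (measurableSet_le hg measurable_const),
      Set.indicator_of_mem (show ξ k ω ∈ {y | g y ≤ g (ξ k ω)} from le_refl (g (ξ k ω))), Pi.one_apply,
      ENNReal.add_sub_cancel_left (by simp)]
  · rw [Set.indicator_of_notMem (show ξ k ω ∉ {z | g z < ⊤} from hgk),
      Set.indicator_of_notMem (show ξ k ω ∉ {z | g z < ⊤} from hgk)]

lemma labelledMinProb_pointMeasure_le_one {E : Type*} [MeasurableSpace E] {ξ : ℕ → Ω → E}
    (hZm : ∀ i, Measurable (Z i)) (hZ : ∀ i, HasLaw (Z i) (uniformOn Set.univ) Pr)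
    (hZi : iIndepFun Z Pr) (j : Fin J) {g : E → ℝ≥0∞} (hg : Measurable g) (ω : Ω) :
    labelledMinProb J g (pointMeasure ξ ω) ≤ 1 := by
  rw [labelledMinProb_pointMeasure hg]
  refine le_trans (le_of_eq ?_)
    ((tsum_inv_mul_thin_le hZm hZ hZi j Set.univ fun k => g (ξ k ω)).trans prob_le_one)
  refine tsum_congr fun k => ?_
  by_cases hgk : g (ξ k ω) < ⊤
  · rw [Set.indicator_of_mem (show ξ k ω ∈ {z | g z < ⊤} from hgk),
      Set.indicator_of_mem (show k ∈ {k | k ∈ (Set.univ : Set ℕ) ∧ g (ξ k ω) < ⊤} from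
        ⟨trivial, hgk⟩),
      deletedMeasure_apply_eq_tsum ξ k ω (measurableSet_le hg measurable_const)]
    congr 4
    ext l
    congr 1
    ext l
    simp
  · rw [Set.indicator_of_notMem (show ξ k ω ∉ {z | g z < ⊤} from hgk),
      Set.indicator_of_notMem fun h => hgk h.2]

/-- By the Mecke formula the mean is at least the integral of `J⁻¹ e^{-s/J}` over the scores `s`,
which is at least `1`. The variable never exceeds `1`, so it equals `1` almost surely. -/
lemma IsPoissonProcess.ae_one_le_labelledMinProb (hm : Measurable m)
    (h : IsPoissonProcess ξ ((θ.withDensity fun u => (m u : ℝ≥0∞)).prod lebesgueNNReal) Pr)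
    (hZm : ∀ i, Measurable (Z i)) (hZ : ∀ i, HasLaw (Z i) (uniformOn Set.univ) Pr)
    (hZi : iIndepFun Z Pr) (j : Fin J) {q : 𝒰 → ℝ≥0} (hq : Measurable q)
    [IsProbabilityMeasure (θ.withDensity fun u => (q u : ℝ≥0∞))]
    (hac : (θ.withDensity fun u => (q u : ℝ≥0∞)) ≪ θ.withDensity fun u => (m u : ℝ≥0∞)) :
    ∀ᵐ ω ∂Pr, 1 ≤ labelledMinProb J (fun z => score m q z.1 z.2) (pointMeasure ξ ω) := by
  have hJ : J ≠ 0 := fun h => by subst h; exact j.elim0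
  have hJ1 : (J : ℝ≥0∞)⁻¹ ≠ 0 := by simp
  have hJ2 : (J : ℝ≥0∞)⁻¹ ≠ ⊤ := by simpa using hJ
  set ν := (θ.withDensity fun u => (m u : ℝ≥0∞)).prod lebesgueNNReal with hν
  set g : 𝒰 × ℝ≥0 → ℝ≥0∞ := fun z => score m q z.1 z.2 with hg_def
  have hg : Measurable g := by fun_prop
  let F : (𝒰 × ℝ≥0) × Measure (𝒰 × ℝ≥0) → ℝ≥0∞ := fun a =>
    {z | g z < ⊤}.indicator
      (fun z => (J : ℝ≥0∞)⁻¹ * thin J (locFin ν a.2 {y | g y ≤ g a.1})) a.1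
  have hR : Measurable fun a : (𝒰 × ℝ≥0) × Measure (𝒰 × ℝ≥0) =>
      locFin ν a.2 {y | g y ≤ g a.1} :=
    measurable_locFin_preimage measurable_snd
      (t := {b : ((𝒰 × ℝ≥0) × Measure (𝒰 × ℝ≥0)) × (𝒰 × ℝ≥0) | g b.2 ≤ g b.1.1})
      (measurableSet_le (by fun_prop) (by fun_prop))
  have hF : Measurable F := by
    have : F = {a : (𝒰 × ℝ≥0) × Measure (𝒰 × ℝ≥0) | g a.1 < ⊤}.indicator
        (fun a => (J : ℝ≥0∞)⁻¹ * thin J (locFin ν a.2 {y | g y ≤ g a.1})) := rfl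
    rw [this]
    exact Measurable.indicator (((measurable_thin J).comp hR).const_mul _)
      (measurableSet_lt (hg.comp measurable_fst) measurable_const)
  have hFi : ∀ i, Measurable fun ω => F (ξ i ω, deletedMeasure ξ i ω) := fun i =>
    hF.comp ((h.measurable i).prodMk (measurable_deletedMeasure h.measurable i))
  have heq : ∀ᵐ ω ∂Pr, ∑' k, F (ξ k ω, deletedMeasure ξ k ω) =
      labelledMinProb J g (pointMeasure ξ ω) := by
    filter_upwards [h.ae_locFin_eq] with ω hω
    rw [labelledMinProb_pointMeasure hg]
    refine tsum_congr fun k => ?_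
    simp only [F, hω.1 k]
    rfl
  have hle : ∀ᵐ ω ∂Pr, ∑' k, F (ξ k ω, deletedMeasure ξ k ω) ≤ 1 := by
    filter_upwards [heq] with ω hω
    rw [hω]
    exact labelledMinProb_pointMeasure_le_one hZm hZ hZi j hg ω
  have hint : ∫⁻ _, 1 ∂Pr ≤ ∫⁻ ω, ∑' k, F (ξ k ω, deletedMeasure ξ k ω) ∂Pr := by
    rw [lintegral_tsum fun i => (hFi i).aemeasurable, h.mecke hF, lintegral_one, measure_univ]
    -- With a one-point space for `v` and `G = c = J⁻¹`, the left side is the total mass of the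
    -- density `q`, namely `1`.
    have key := lintegral_div_le_lintegral_expNeg hm hq hac (Kernel.const 𝒰 (Measure.dirac ()))
      (G := fun _ => (J : ℝ≥0∞)⁻¹) (c := fun _ => (J : ℝ≥0∞)⁻¹) measurable_const measurable_const
    simp only [ENNReal.div_self hJ1 hJ2, lintegral_one, measure_univ, lintegral_const, mul_one,
      Kernel.const_apply] at key
    refine key.trans (lintegral_mono fun z => ?_)
    by_cases hz : g z < ⊤
    · have h1 : ∫⁻ ω, F (z, pointMeasure ξ ω) ∂Pr =
          (J : ℝ≥0∞)⁻¹ * ∫⁻ ω, isZero (pointMeasure ξ ω ∅) *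
            thin J (pointMeasure ξ ω {y | g y ≤ g z}) ∂Pr := by
        rw [← lintegral_const_mul]
        · refine lintegral_congr_ae ?_
          filter_upwards [h.ae_locFin_eq] with ω hω
          simp only [F, hω.2]
          rw [Set.indicator_of_mem (show z ∈ {z | g z < ⊤} from hz)]
          simp
        · have hN := measurable_pointMeasure h.measurable
          exact (measurable_isZero.comp ((Measure.measurable_coe MeasurableSet.empty).comp hN)).mul
            ((measurable_thin J).comp ((Measure.measurable_coe
              (measurableSet_le hg measurable_const)).comp hN))
      rw [h1]
      gcongr
      refine le_trans ?_ (h.expNeg_le_lintegral hJ MeasurableSet.empty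
        (measurableSet_le hg measurable_const))
      refine expNeg_antitone ?_
      rw [measure_empty, zero_add, ENNReal.div_eq_inv_mul]
      gcongr
      exact measure_score_le hm hq (g z)
    · have : score m q z.1 z.2 = ⊤ := not_lt_top_iff.1 hz
      rw [this, ENNReal.mul_top hJ1]
      simp
  have := ae_eq_of_ae_le_of_lintegral_le hle
    (ne_top_of_le_ne_top ENNReal.one_ne_top
      ((lintegral_mono_ae hle).trans (by simp))) (by fun_prop) hint
  filter_upwards [this, heq] with ω h1 h2
  rw [← h2, h1]

end Poisson

/-! ### The encoder: law and uniqueness of the selection -/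

section Matching

variable {Ω 𝒳 𝒰 V : Type*} [MeasurableSpace Ω] [MeasurableSpace 𝒳] [MeasurableSpace 𝒰]
  [MeasurableSpace V] {J : ℕ} {θ : Measure 𝒰} [SigmaFinite θ] {m : 𝒰 → ℝ≥0}
  {Pr : Measure Ω} [IsProbabilityMeasure Pr]
  {ξ : ℕ → Ω → 𝒰 × ℝ≥0} {Z : ℕ → Ω → Fin J} {X : Ω → 𝒳} {PX : Measure 𝒳}
  {PU : Kernel 𝒳 𝒰} [IsMarkovKernel PU] {p : 𝒳 → 𝒰 → ℝ≥0}
  {κ : Kernel (𝒳 × 𝒰) V} [IsMarkovKernel κ] {Yv : Ω → V}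

/-- The first coordinate of the point with the least score for the density `p x`. -/
noncomputable def selected (m : 𝒰 → ℝ≥0) (p : 𝒳 → 𝒰 → ℝ≥0) (a : 𝒳 × (ℕ → 𝒰 × ℝ≥0)) : 𝒰 :=
  (a.2 (argmin Set.univ fun i => score m (p a.1) (a.2 i).1 (a.2 i).2)).1

lemma measurable_selected (hm : Measurable m) (hp : Measurable (Function.uncurry p)) :
    Measurable (selected m p) := by
  have h1 : Measurable fun a : 𝒳 × (ℕ → 𝒰 × ℝ≥0) =>
      argmin Set.univ fun i => score m (p a.1) (a.2 i).1 (a.2 i).2 :=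
    measurable_argmin (fun _ => MeasurableSet.const _)
      fun i => measurable_score_comp hm hp (by fun_prop) (by fun_prop) (by fun_prop)
  exact measurable_eval_nat (f := fun i (a : 𝒳 × (ℕ → 𝒰 × ℝ≥0)) => (a.2 i).1)
    (fun i => by fun_prop) h1

lemma selected_eq {x : 𝒳} {e : ℕ → 𝒰 × ℝ≥0} {i : ℕ}
    (h : IsStrictMin Set.univ (fun k => score m (p x) (e k).1 (e k).2) i) :
    selected m p (x, e) = (e i).1 := by
  rw [selected]
  simp only
  rw [h.argmin_eq]

lemma sum_lintegral_div_le {ι : Type*} [Fintype ι] {h : 𝒰 → ℝ≥0}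
    (hm : Measurable m) (hh : Measurable h)
    (hac : (θ.withDensity fun u => (h u : ℝ≥0∞)) ≪ θ.withDensity fun u => (m u : ℝ≥0∞))
    (κ : Kernel 𝒰 V) [IsMarkovKernel κ] {G c : ι → 𝒰 × V → ℝ≥0∞}
    (hG : ∀ j, Measurable (G j)) (hc : ∀ j, Measurable (c j)) :
    ∫⁻ u, ∫⁻ v, ∑ j, G j (u, v) / c j (u, v) ∂κ u ∂(θ.withDensity fun u => (h u : ℝ≥0∞)) ≤
      ∫⁻ z, ∫⁻ v, ∑ j, G j (z.1, v) * expNeg (c j (z.1, v) * score m h z.1 z.2) ∂κ z.1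
        ∂(θ.withDensity fun u => (m u : ℝ≥0∞)).prod lebesgueNNReal := by
  have he := measurable_expNeg
  have h1 : ∀ j, Measurable fun a : 𝒰 × V => G j a / c j a := fun j => (hG j).div (hc j)
  have h2 : ∀ j, Measurable fun a : (𝒰 × ℝ≥0) × V =>
      G j (a.1.1, a.2) * expNeg (c j (a.1.1, a.2) * score m h a.1.1 a.1.2) := by
    intro j
    have := hG j
    have := hc j
    have : Measurable fun a : (𝒰 × ℝ≥0) × V => score m h a.1.1 a.1.2 := by fun_prop
    fun_prop
  have h3 : ∀ j, Measurable fun z : 𝒰 × ℝ≥0 =>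
      ∫⁻ v, G j (z.1, v) * expNeg (c j (z.1, v) * score m h z.1 z.2) ∂κ z.1 := fun j =>
    (h2 j).lintegral_kernel_prod_right' (κ := κ.comap Prod.fst measurable_fst)
  have e1 : ∀ u, ∫⁻ v, ∑ j, G j (u, v) / c j (u, v) ∂κ u =
      ∑ j, ∫⁻ v, G j (u, v) / c j (u, v) ∂κ u := fun u =>
    lintegral_finsetSum _ fun j _ => (h1 j).comp measurable_prodMk_left
  have e2 : ∀ z : 𝒰 × ℝ≥0,
      ∫⁻ v, ∑ j, G j (z.1, v) * expNeg (c j (z.1, v) * score m h z.1 z.2) ∂κ z.1 =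
      ∑ j, ∫⁻ v, G j (z.1, v) * expNeg (c j (z.1, v) * score m h z.1 z.2) ∂κ z.1 := fun z =>
    lintegral_finsetSum _ fun j _ => (h2 j).comp (measurable_prodMk_left (x := z))
  simp_rw [e1, e2]
  rw [lintegral_finsetSum _ fun j _ => (h1 j).lintegral_kernel_prod_right',
    lintegral_finsetSum _ fun j _ => h3 j]
  exact Finset.sum_le_sum fun j _ => lintegral_div_le_lintegral_expNeg hm hh hac κ (hG j) (hc j)

/-- `IsCodebook.le_measure` for the scores of the densities `p x`. -/
lemma IsCodebook.lintegral_div_le_measure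
    (h : IsCodebook ξ Z X ((θ.withDensity fun u => (m u : ℝ≥0∞)).prod lebesgueNNReal) PX Pr)
    (hm : Measurable m) (hp : Measurable (Function.uncurry p))
    (hPU : ∀ᵐ x ∂PX, PU x = θ.withDensity (fun u => (p x u : ℝ≥0∞)) ∧
      PU x ≪ θ.withDensity fun u => (m u : ℝ≥0∞))
    (hY : HasCondDistrib Yv
      (fun ω => ((X ω, selected m p (X ω, fun i => ξ i ω)), ((fun i => ξ i ω), fun i => Z i ω)))
      (κ.prodMkRight ((ℕ → 𝒰 × ℝ≥0) × (ℕ → Fin J))) Pr)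
    {B : Set ((𝒳 × ((ℕ → 𝒰 × ℝ≥0) × (ℕ → Fin J))) × V)} (hB : MeasurableSet B)
    {Λ : 𝒳 → ((𝒰 × ℝ≥0) × Measure (𝒰 × ℝ≥0)) × V → ℝ≥0∞} (hΛm : ∀ x, Measurable (Λ x))
    (hΛ : ∀ x, ∀ᵐ ω ∂Pr, ∀ i,
      IsStrictMin Set.univ (fun k => score m (p x) (ξ k ω).1 (ξ k ω).2) i → ∀ v,
      Λ x ((ξ i ω, deletedMeasure ξ i ω), v) ≤
        Pr {ω' | ((x, ((fun k => ξ k ω), fun k => Z k ω')), v) ∈ B})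
    {ι : Type*} [Fintype ι] {G c : 𝒳 → ι → 𝒰 × V → ℝ≥0∞}
    (hG : ∀ x j, Measurable (G x j)) (hc : ∀ x j, Measurable (c x j)) (hc0 : ∀ x j a, c x j a ≠ 0)
    (hle : ∀ᵐ x ∂PX,
      ∀ᵐ z ∂(θ.withDensity fun u => (m u : ℝ≥0∞)).prod lebesgueNNReal,
      score m (p x) z.1 z.2 < ⊤ → ∀ᵐ v ∂κ (x, z.1),
      ∑ j, G x j (z.1, v) * expNeg (c x j (z.1, v) * score m (p x) z.1 z.2) ≤
        ∫⁻ ω, isZero (pointMeasure ξ ω {y | score m (p x) y.1 y.2 ≤ score m (p x) z.1 z.2}) *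
          Λ x ((z, pointMeasure ξ ω), v) ∂Pr) :
    ∫⁻ x, ∫⁻ u, ∫⁻ v, ∑ j, G x j (u, v) / c x j (u, v) ∂κ (x, u) ∂PU x ∂PX ≤
      Pr {ω | ((X ω, ((fun k => ξ k ω), fun k => Z k ω)), Yv ω) ∈ B} := by
  refine le_trans ?_ (h.le_measure (measurable_selected hm hp)
    (f := fun x z => score m (p x) z.1 z.2)
    (measurable_score_comp hm hp (by fun_prop) (by fun_prop) (by fun_prop))
    (fun x e i hs => selected_eq hs) hY hB hΛm hΛ)
  refine lintegral_mono_ae ?_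
  filter_upwards [hPU, hle] with x hx hlex
  have hpx : Measurable (p x) := hp.comp measurable_prodMk_left
  have hac := hx.2
  rw [hx.1] at hac ⊢
  refine (sum_lintegral_div_le hm hpx hac (κ.sectR x) (hG x) (hc x)).trans ?_
  refine lintegral_mono_ae ?_
  filter_upwards [hlex] with z hz
  by_cases hlt : score m (p x) z.1 z.2 < ⊤
  · rw [Set.indicator_of_mem (show z ∈ {z | score m (p x) z.1 z.2 < ⊤} from hlt)]
    exact lintegral_mono_ae (hz hlt)
  -- Points of infinite score contribute nothing, because `c ≠ 0` makes the exponential vanish.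
  · have htop : score m (p x) z.1 z.2 = ⊤ := not_lt_top_iff.1 hlt
    simp [htop, ENNReal.mul_top (hc0 _ _ _)]

lemma IsCodebook.isProbabilityMeasure_input {ν : Measure (𝒰 × ℝ≥0)}
    (h : IsCodebook ξ Z X ν PX Pr) : IsProbabilityMeasure PX := by
  rw [← h.hasLaw_input.map_eq]
  exact Measure.isProbabilityMeasure_map h.measurable_input.aemeasurable

/-- The general bound with no label condition: the void probability is at least `e^{-s}`, so `c = 1`
and no mass is lost in the time integral. -/
lemma IsCodebook.compProd_le_measure [NeZero J]
    (h : IsCodebook ξ Z X ((θ.withDensity fun u => (m u : ℝ≥0∞)).prod lebesgueNNReal) PX Pr)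
    (hm : Measurable m) (hp : Measurable (Function.uncurry p))
    (hPU : ∀ᵐ x ∂PX, PU x = θ.withDensity (fun u => (p x u : ℝ≥0∞)) ∧
      PU x ≪ θ.withDensity fun u => (m u : ℝ≥0∞))
    (hY : HasCondDistrib Yv
      (fun ω => ((X ω, selected m p (X ω, fun i => ξ i ω)), ((fun i => ξ i ω), fun i => Z i ω)))
      (κ.prodMkRight ((ℕ → 𝒰 × ℝ≥0) × (ℕ → Fin J))) Pr)
    {A : Set (𝒳 × 𝒰)} (hA : MeasurableSet A) :
    (PX ⊗ₘ PU) A ≤ Pr {ω | (X ω, selected m p (X ω, fun i => ξ i ω)) ∈ A ∧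
      ∃ i, IsStrictMin Set.univ (fun k => score m (p (X ω)) (ξ k ω).1 (ξ k ω).2) i} := by
  have := h.isProbabilityMeasure_input
  have hsel := measurable_selected hm hp
  let B : Set ((𝒳 × ((ℕ → 𝒰 × ℝ≥0) × (ℕ → Fin J))) × V) :=
    {a | (a.1.1, selected m p (a.1.1, a.1.2.1)) ∈ A ∧
      ∃ i, IsStrictMin Set.univ
        (fun k => score m (p a.1.1) (a.1.2.1 k).1 (a.1.2.1 k).2) i}
  have hB : MeasurableSet B := by
    have h1 : MeasurableSet {a : (𝒳 × ((ℕ → 𝒰 × ℝ≥0) × (ℕ → Fin J))) × V |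
        (a.1.1, selected m p (a.1.1, a.1.2.1)) ∈ A} :=
      (show Measurable fun a : (𝒳 × ((ℕ → 𝒰 × ℝ≥0) × (ℕ → Fin J))) × V =>
        (a.1.1, selected m p (a.1.1, a.1.2.1)) by fun_prop) hA
    exact h1.inter (measurableSet_exists_isStrictMin (fun _ => MeasurableSet.const _)
      fun k => measurable_score_comp hm hp (by fun_prop) (by fun_prop) (by fun_prop))
  have key := h.lintegral_div_le_measure hm hp hPU hY hB
    (Λ := fun x a => A.indicator 1 (x, a.1.1.1)) (ι := Unit)
    (G := fun x _ a => A.indicator 1 (x, a.1)) (c := fun _ _ _ => 1)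
    (fun x => (measurable_one.indicator hA).comp (by fun_prop)) ?_
    (fun x _ => (measurable_one.indicator hA).comp (by fun_prop))
    (fun _ _ => measurable_const) (fun _ _ _ => one_ne_zero) ?_
  · refine le_trans (le_of_eq ?_) key
    rw [Measure.compProd_apply hA]
    refine lintegral_congr fun x => ?_
    simp only [Finset.univ_unique, Finset.sum_const, Finset.card_singleton, one_smul, div_one,
      lintegral_const, measure_univ, mul_one]
    rw [← lintegral_indicator_one (measurable_prodMk_left hA)]
    rfl
  · intro x
    refine Filter.Eventually.of_forall fun ω i hi v => ?_
    by_cases hiA : (x, (ξ i ω).1) ∈ A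
    · rw [Set.indicator_of_mem hiA, Pi.one_apply]
      have : {ω' | ((x, ((fun k => ξ k ω), fun k => Z k ω')), v) ∈ B} = Set.univ := by
        refine Set.eq_univ_of_forall fun ω' => ⟨?_, i, hi⟩
        simpa only [selected_eq (e := fun k => ξ k ω) hi] using hiA
      rw [this, measure_univ]
    · rw [Set.indicator_of_notMem hiA]; exact zero_le
  · filter_upwards [hPU] with x hx
    have hpx : Measurable (p x) := hp.comp measurable_prodMk_left
    have : IsProbabilityMeasure (θ.withDensity fun u => (p x u : ℝ≥0∞)) := by
      rw [← hx.1]; infer_instance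
    refine Filter.Eventually.of_forall fun z _ => Filter.Eventually.of_forall fun v => ?_
    have h1 := h.poisson.expNeg_le_lintegral (NeZero.ne J)
      (R₁ := {y | score m (p x) y.1 y.2 ≤ score m (p x) z.1 z.2}) (R₂ := ∅)
      (measurableSet_le (by fun_prop) measurable_const) MeasurableSet.empty
    simp only [measure_empty, ENNReal.zero_div, add_zero, thin_zero, mul_one] at h1
    by_cases hzA : (x, z.1) ∈ A
    · simp only [Set.indicator_of_mem hzA, Pi.one_apply, one_mul, mul_one,
        Finset.univ_unique, Finset.sum_const, Finset.card_singleton, one_smul]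
      exact (expNeg_antitone (measure_score_le hm hpx _)).trans h1
    · simp [Set.indicator_of_notMem hzA]

/-- Two probability measures, one dominated by the other, coincide; hence the lower bound suffices.
-/
lemma IsCodebook.hasLaw_selected [NeZero J]
    (h : IsCodebook ξ Z X ((θ.withDensity fun u => (m u : ℝ≥0∞)).prod lebesgueNNReal) PX Pr)
    (hm : Measurable m) (hp : Measurable (Function.uncurry p))
    (hPU : ∀ᵐ x ∂PX, PU x = θ.withDensity (fun u => (p x u : ℝ≥0∞)) ∧
      PU x ≪ θ.withDensity fun u => (m u : ℝ≥0∞))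
    (hY : HasCondDistrib Yv
      (fun ω => ((X ω, selected m p (X ω, fun i => ξ i ω)), ((fun i => ξ i ω), fun i => Z i ω)))
      (κ.prodMkRight ((ℕ → 𝒰 × ℝ≥0) × (ℕ → Fin J))) Pr) :
    HasLaw (fun ω => (X ω, selected m p (X ω, fun i => ξ i ω))) (PX ⊗ₘ PU) Pr := by
  have := h.isProbabilityMeasure_input
  have hX := h.measurable_input
  have hξ := h.measurable_points
  have hsel := measurable_selected hm hp
  have hmeas : Measurable fun ω => (X ω, selected m p (X ω, fun i => ξ i ω)) :=
    hX.prodMk (hsel.comp (hX.prodMk hξ))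
  have : IsProbabilityMeasure (Pr.map fun ω => (X ω, selected m p (X ω, fun i => ξ i ω))) :=
    Measure.isProbabilityMeasure_map hmeas.aemeasurable
  refine ⟨hmeas.aemeasurable, (Measure.eq_of_le_of_isProbabilityMeasure ?_).symm⟩
  refine Measure.le_intro fun A hA _ => ?_
  rw [Measure.map_apply hmeas hA]
  exact (h.compProd_le_measure hm hp hPU hY hA).trans (measure_mono fun ω hω => hω.1)

lemma IsCodebook.ae_exists_isStrictMin [NeZero J]
    (h : IsCodebook ξ Z X ((θ.withDensity fun u => (m u : ℝ≥0∞)).prod lebesgueNNReal) PX Pr)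
    (hm : Measurable m) (hp : Measurable (Function.uncurry p))
    (hPU : ∀ᵐ x ∂PX, PU x = θ.withDensity (fun u => (p x u : ℝ≥0∞)) ∧
      PU x ≪ θ.withDensity fun u => (m u : ℝ≥0∞))
    (hY : HasCondDistrib Yv
      (fun ω => ((X ω, selected m p (X ω, fun i => ξ i ω)), ((fun i => ξ i ω), fun i => Z i ω)))
      (κ.prodMkRight ((ℕ → 𝒰 × ℝ≥0) × (ℕ → Fin J))) Pr) :
    ∀ᵐ ω ∂Pr, ∃ i, IsStrictMin Set.univ
      (fun k => score m (p (X ω)) (ξ k ω).1 (ξ k ω).2) i := by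
  have := h.isProbabilityMeasure_input
  have hX := h.measurable_input
  have hξ := h.poisson.measurable
  have h1 := h.compProd_le_measure hm hp hPU hY MeasurableSet.univ
  simp only [measure_univ, Set.mem_univ, true_and] at h1
  have hmeas : MeasurableSet {ω | ∃ i, IsStrictMin Set.univ
      (fun k => score m (p (X ω)) (ξ k ω).1 (ξ k ω).2) i} := by
    exact measurableSet_exists_isStrictMin (fun _ => MeasurableSet.const _)
      fun k => measurable_score_comp hm hp hX (hξ k).fst (hξ k).snd
  exact (prob_compl_eq_zero_iff hmeas).2 (le_antisymm prob_le_one h1)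

end Matching

/-! ### The decoders: uniqueness and success probability -/

section Decoding

variable {Ω 𝒳 𝒰 V : Type*} [MeasurableSpace Ω] [MeasurableSpace 𝒳] [MeasurableSpace 𝒰]
  [MeasurableSpace V] {J : ℕ} {θ : Measure 𝒰} [SigmaFinite θ] {m : 𝒰 → ℝ≥0}
  {Pr : Measure Ω} [IsProbabilityMeasure Pr]
  {ξ : ℕ → Ω → 𝒰 × ℝ≥0} {Z : ℕ → Ω → Fin J} {X : Ω → 𝒳} {PX : Measure 𝒳}
  {PU : Kernel 𝒳 𝒰} [IsMarkovKernel PU] {p : 𝒳 → 𝒰 → ℝ≥0}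
  {κ : Kernel (𝒳 × 𝒰) V} [IsMarkovKernel κ] {Yv : Ω → V}

lemma measurable_locFin_sublevel {E : Type*} [MeasurableSpace E] {ν : Measure E} [SigmaFinite ν]
    {g : V → E → ℝ≥0∞} (hg : Measurable (Function.uncurry g)) :
    Measurable fun a : (E × Measure E) × V => locFin ν a.1.2 {y | g a.2 y ≤ g a.2 a.1.1} :=
  measurable_locFin_preimage (A := (E × Measure E) × V) (by fun_prop)
    (t := {b : ((E × Measure E) × V) × E | g b.1.2 b.2 ≤ g b.1.2 b.1.1.1})
    (measurableSet_le (hg.comp (f := fun b : ((E × Measure E) × V) × E => (b.1.2, b.2))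
      (by fun_prop)) (hg.comp (f := fun b : ((E × Measure E) × V) × E => (b.1.2, b.1.1.1))
      (by fun_prop)))

lemma measurable_locFin_level {E : Type*} [MeasurableSpace E] {ν : Measure E} [SigmaFinite ν]
    {g : V → E → ℝ≥0∞} (hg : Measurable (Function.uncurry g)) :
    Measurable fun a : (E × Measure E) × V =>
      locFin ν a.1.2 {y | g a.2 y = g a.2 a.1.1 ∧ g a.2 y < ⊤} := by
  have h1 : Measurable fun b : ((E × Measure E) × V) × E => g b.1.2 b.2 :=
    hg.comp (f := fun b : ((E × Measure E) × V) × E => (b.1.2, b.2)) (by fun_prop)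
  have h2 : Measurable fun b : ((E × Measure E) × V) × E => g b.1.2 b.1.1.1 :=
    hg.comp (f := fun b : ((E × Measure E) × V) × E => (b.1.2, b.1.1.1)) (by fun_prop)
  exact measurable_locFin_preimage (A := (E × Measure E) × V) (by fun_prop)
    (t := {b : ((E × Measure E) × V) × E | g b.1.2 b.2 = g b.1.2 b.1.1.1 ∧ g b.1.2 b.2 < ⊤})
    ((measurableSet_eq_fun h1 h2).inter (measurableSet_lt h1 measurable_const))

lemma measurable_labelledMinProb {E : Type*} [MeasurableSpace E] {ν : Measure E} [SigmaFinite ν]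
    {g : V → E → ℝ≥0∞} (hg : Measurable (Function.uncurry g)) :
    Measurable fun a : (E × Measure E) × V => labelledMinProb J (g a.2) (locFin ν a.1.2) := by
  have h1 : Measurable fun b : ((E × Measure E) × V) × E =>
      locFin ν b.1.1.2 {y | g b.1.2 y ≤ g b.1.2 b.2} :=
    (measurable_locFin_sublevel hg).comp
      (f := fun b : ((E × Measure E) × V) × E => ((b.2, b.1.1.2), b.1.2)) (by fun_prop)
  have h2 : Measurable ({b : ((E × Measure E) × V) × E | g b.1.2 b.2 < ⊤}.indicator
      (fun b => (J : ℝ≥0∞)⁻¹ * thin J (locFin ν b.1.1.2 {y | g b.1.2 y ≤ g b.1.2 b.2} - 1))) :=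
    Measurable.indicator (((measurable_thin J).comp (h1.sub_const 1)).const_mul _)
      (measurableSet_lt (hg.comp (f := fun b : ((E × Measure E) × V) × E => (b.1.2, b.2))
        (by fun_prop)) measurable_const)
  exact measurable_lintegral_locFin (A := (E × Measure E) × V) (by fun_prop) h2

/-- Almost surely, each decoder has a unique choice. -/
lemma IsCodebook.ae_exists_isStrictMin_label
    (h : IsCodebook ξ Z X ((θ.withDensity fun u => (m u : ℝ≥0∞)).prod lebesgueNNReal) PX Pr)
    (hm : Measurable m) (hp : Measurable (Function.uncurry p))
    (hPU : ∀ᵐ x ∂PX, PU x = θ.withDensity (fun u => (p x u : ℝ≥0∞)) ∧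
      PU x ≪ θ.withDensity fun u => (m u : ℝ≥0∞))
    (hY : HasCondDistrib Yv
      (fun ω => ((X ω, selected m p (X ω, fun i => ξ i ω)), ((fun i => ξ i ω), fun i => Z i ω)))
      (κ.prodMkRight ((ℕ → 𝒰 × ℝ≥0) × (ℕ → Fin J))) Pr) (hYm : Measurable Yv)
    {q : V → 𝒰 → ℝ≥0} (hq : Measurable (Function.uncurry q))
    (hQ : ∀ᵐ x ∂PX, ∀ᵐ u ∂PU x, ∀ᵐ v ∂κ (x, u),
      IsProbabilityMeasure (θ.withDensity fun u => (q v u : ℝ≥0∞)) ∧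
      (θ.withDensity fun u => (q v u : ℝ≥0∞)) ≪ θ.withDensity fun u => (m u : ℝ≥0∞))
    (j : Fin J) :
    ∀ᵐ ω ∂Pr, ∃ i, IsStrictMin {i | Z i ω = j}
      (fun k => score m (q (Yv ω)) (ξ k ω).1 (ξ k ω).2) i := by
  have hJ : J ≠ 0 := fun h => by subst h; exact j.elim0
  have := h.isProbabilityMeasure_input
  set ν := (θ.withDensity fun u => (m u : ℝ≥0∞)).prod lebesgueNNReal with hν
  let g : V → 𝒰 × ℝ≥0 → ℝ≥0∞ := fun v z => score m (q v) z.1 z.2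
  have hg : Measurable (Function.uncurry g) :=
    measurable_score_comp hm hq (by fun_prop) (by fun_prop) (by fun_prop)
  have hgv : ∀ v, Measurable (g v) := fun v => hg.comp measurable_prodMk_left
  let B : Set ((𝒳 × ((ℕ → 𝒰 × ℝ≥0) × (ℕ → Fin J))) × V) :=
    {a | ∃ i, IsStrictMin {l | a.1.2.2 l = j} (fun k => g a.2 (a.1.2.1 k)) i}
  have hB : MeasurableSet B := measurableSet_exists_isStrictMin
    (fun i => (show Measurable fun a : (𝒳 × ((ℕ → 𝒰 × ℝ≥0) × (ℕ → Fin J))) × V =>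
      a.1.2.2 i by fun_prop) (MeasurableSet.singleton j))
    fun k => hg.comp (f := fun a : (𝒳 × ((ℕ → 𝒰 × ℝ≥0) × (ℕ → Fin J))) × V =>
      (a.2, a.1.2.1 k)) (by fun_prop)
  -- The remaining points almost surely have, over the labels, a strict minimizer labelled `j`, and
  -- none of them ties with the selected point at a finite score. On `T` the decoder's minimizer is
  -- unique with conditional probability one.
  let T : Set (((𝒰 × ℝ≥0) × Measure (𝒰 × ℝ≥0)) × V) :=
    {a | 1 ≤ labelledMinProb J (g a.2) (locFin ν a.1.2) ∧
      locFin ν a.1.2 {y | g a.2 y = g a.2 a.1.1 ∧ g a.2 y < ⊤} = 0}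
  have hT : MeasurableSet T := by
    exact (measurableSet_le measurable_const (measurable_labelledMinProb hg)).inter
      (measurable_locFin_level hg (MeasurableSet.singleton 0))
  have key := h.lintegral_div_le_measure hm hp hPU hY hB
    (Λ := fun _ => T.indicator 1) (ι := Unit)
    (G := fun _ _ _ => 1) (c := fun _ _ _ => 1)
    (fun _ => measurable_one.indicator hT) ?_
    (fun _ _ => measurable_const) (fun _ _ => measurable_const) (fun _ _ _ => one_ne_zero) ?_
  · simp only [Finset.univ_unique, Finset.sum_const, Finset.card_singleton, one_smul, div_one,
      lintegral_const, measure_univ, mul_one] at key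
    have hξ := h.measurable_points
    have hZ := h.measurable_labels
    have hX := h.measurable_input
    have hmeas : MeasurableSet {ω | ((X ω, ((fun k => ξ k ω), fun k => Z k ω)), Yv ω) ∈ B} :=
      ((hX.prodMk (hξ.prodMk hZ)).prodMk hYm) hB
    exact (prob_compl_eq_zero_iff hmeas).2 (le_antisymm prob_le_one key)
  · intro x
    filter_upwards [h.poisson.ae_locFin_eq] with ω hω i _ v
    by_cases hmem : ((ξ i ω, deletedMeasure ξ i ω), v) ∈ T
    · rw [Set.indicator_of_mem hmem, Pi.one_apply]
      obtain ⟨h1, h2⟩ := hmem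
      simp only [hω.1 i] at h1 h2
      have hlev : MeasurableSet {y | g v y = g v (ξ i ω) ∧ g v y < ⊤} :=
        (measurableSet_eq_fun (hgv v) measurable_const).inter
          (measurableSet_lt (hgv v) measurable_const)
      rw [deletedMeasure_eq_zero_iff ξ i ω hlev] at h2
      refine h1.trans ((labelledMinProb_deletedMeasure_le h.measurable_label h.hasLaw_label
        h.indep_label j (hgv v) i ω).trans (measure_mono ?_))
      rintro ω' ⟨k, hk, hs⟩
      exact exists_isStrictMin_of_compl hk hs h2
    · rw [Set.indicator_of_notMem hmem]; exact zero_le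
  · filter_upwards [hPU, hQ] with x hx hQx
    have hpx : Measurable (p x) := hp.comp measurable_prodMk_left
    have : IsProbabilityMeasure (θ.withDensity fun u => (p x u : ℝ≥0∞)) := by
      rw [← hx.1]; infer_instance
    rw [hx.1] at hQx
    filter_upwards [ae_of_score_lt_top hm hpx hQx] with z hz hlt
    filter_upwards [(hz hlt).2.2.2] with v hv
    have := hv.1
    have hqv : Measurable (q v) := hq.comp measurable_prodMk_left
    have h1 := h.poisson.expNeg_le_lintegral hJ
      (R₁ := {y | score m (p x) y.1 y.2 ≤ score m (p x) z.1 z.2}) (R₂ := ∅)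
      (measurableSet_le (by fun_prop) measurable_const) MeasurableSet.empty
    simp only [measure_empty, ENNReal.zero_div, add_zero, thin_zero, mul_one] at h1
    -- Ties at infinite score are excluded by the second condition; they would not be null in
    -- general, since `q` may vanish on a set of positive `μ`-measure.
    have hnull : ν {y | g v y = g v z ∧ g v y < ⊤} = 0 := by
      by_cases hgz : g v z = ⊤
      · have : {y | g v y = g v z ∧ g v y < ⊤} = ∅ := by
          refine Set.eq_empty_of_forall_notMem fun y hy => ?_
          rw [Set.mem_ofPred_eq, hgz] at hy
          exact hy.2.ne hy.1
        rw [this, measure_empty]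
      · exact measure_mono_null (fun y hy => hy.1) (measure_score_eq hm hqv hgz)
    have h2 : ∀ᵐ ω ∂Pr, ((z, pointMeasure ξ ω), v) ∈ T := by
      filter_upwards [h.poisson.ae_locFin_eq,
        h.poisson.ae_eq_zero ((measurableSet_eq_fun (hgv v) measurable_const).inter
          (measurableSet_lt (hgv v) measurable_const)) hnull,
        h.poisson.ae_one_le_labelledMinProb hm h.measurable_label h.hasLaw_label h.indep_label j
          hqv hv.2] with ω hω h3 h4
      refine ⟨?_, ?_⟩
      · simp only [hω.2]; exact h4
      · simp only [hω.2]; exact h3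
    simp only [Finset.univ_unique, Finset.sum_const, Finset.card_singleton, one_smul, one_mul]
    refine ((expNeg_antitone (measure_score_le hm hpx _)).trans h1).trans
      (lintegral_mono_ae ?_)
    filter_upwards [h2] with ω hω
    rw [Set.indicator_of_mem hω, Pi.one_apply, mul_one]

lemma inv_div_one_add_div {J : ℕ} (hJ : J ≠ 0) (r : ℝ≥0∞) :
    (J : ℝ≥0∞)⁻¹ / (1 + r / J) = (J + r)⁻¹ := by
  have h1 : (J : ℝ≥0∞) ≠ 0 := by simpa using hJ
  rw [div_eq_mul_inv, ← ENNReal.mul_inv (Or.inl h1) (Or.inl (by simp)), mul_add, mul_one,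
    ENNReal.mul_div_cancel h1 (by simp)]

/-- A lower bound on the joint probability of an event for `(X, U, Y)` and of some decoder finding
the point selected by the encoder. -/
lemma IsCodebook.lintegral_sum_inv_le_measure [NeZero J] {ι : Type*} [Fintype ι]
    (h : IsCodebook ξ Z X ((θ.withDensity fun u => (m u : ℝ≥0∞)).prod lebesgueNNReal) PX Pr)
    (hm : Measurable m) (hp : Measurable (Function.uncurry p))
    (hPU : ∀ᵐ x ∂PX, PU x = θ.withDensity (fun u => (p x u : ℝ≥0∞)) ∧
      PU x ≪ θ.withDensity fun u => (m u : ℝ≥0∞))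
    (hY : HasCondDistrib Yv
      (fun ω => ((X ω, selected m p (X ω, fun i => ξ i ω)), ((fun i => ξ i ω), fun i => Z i ω)))
      (κ.prodMkRight ((ℕ → 𝒰 × ℝ≥0) × (ℕ → Fin J))) Pr)
    (gr : ι → Fin J) {q : ι → V → 𝒰 → ℝ≥0} (hq : ∀ k, Measurable (Function.uncurry (q k)))
    (hQ : ∀ k, ∀ᵐ x ∂PX, ∀ᵐ u ∂PU x, ∀ᵐ v ∂κ (x, u),
      IsProbabilityMeasure (θ.withDensity fun u => (q k v u : ℝ≥0∞)))
    {D : Set ((𝒳 × 𝒰) × V)} (hD : MeasurableSet D) :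
    ∫⁻ x, ∫⁻ u, ∫⁻ v, D.indicator 1 ((x, u), v) * ∑ j, ((J : ℝ≥0∞) +
        ⨅ k, ⨅ _ : gr k = j, ratio (p x u) (q k v u))⁻¹ ∂κ (x, u) ∂PU x ∂PX ≤
      Pr {ω | ((X ω, selected m p (X ω, fun i => ξ i ω)), Yv ω) ∈ D ∧
        ∃ i, IsStrictMin Set.univ (fun k => score m (p (X ω)) (ξ k ω).1 (ξ k ω).2) i ∧
          ∃ k, IsStrictMin {l | Z l ω = gr k}
            (fun l => score m (q k (Yv ω)) (ξ l ω).1 (ξ l ω).2) i} := by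
  have hJ : J ≠ 0 := NeZero.ne J
  have := h.isProbabilityMeasure_input
  have hsel := measurable_selected hm hp
  set ν := (θ.withDensity fun u => (m u : ℝ≥0∞)).prod lebesgueNNReal with hν
  let g : ι → V → 𝒰 × ℝ≥0 → ℝ≥0∞ := fun k v z => score m (q k v) z.1 z.2
  have hg : ∀ k, Measurable (Function.uncurry (g k)) := fun k =>
    measurable_score_comp hm (hq k) (by fun_prop) (by fun_prop) (by fun_prop)
  have hgv : ∀ k v, Measurable (g k v) := fun k v => (hg k).comp measurable_prodMk_left
  let B : Set ((𝒳 × ((ℕ → 𝒰 × ℝ≥0) × (ℕ → Fin J))) × V) :=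
    {a | ((a.1.1, selected m p (a.1.1, a.1.2.1)), a.2) ∈ D ∧
      ∃ i, IsStrictMin Set.univ
        (fun k => score m (p a.1.1) (a.1.2.1 k).1 (a.1.2.1 k).2) i ∧
        ∃ k, IsStrictMin {l | a.1.2.2 l = gr k} (fun l => g k a.2 (a.1.2.1 l)) i}
  have hB : MeasurableSet B := by
    have h1 : MeasurableSet {a : (𝒳 × ((ℕ → 𝒰 × ℝ≥0) × (ℕ → Fin J))) × V |
        ((a.1.1, selected m p (a.1.1, a.1.2.1)), a.2) ∈ D} :=
      (show Measurable fun a : (𝒳 × ((ℕ → 𝒰 × ℝ≥0) × (ℕ → Fin J))) × V =>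
        ((a.1.1, selected m p (a.1.1, a.1.2.1)), a.2) by fun_prop) hD
    have h2 : ∀ i, MeasurableSet {a : (𝒳 × ((ℕ → 𝒰 × ℝ≥0) × (ℕ → Fin J))) × V |
        IsStrictMin Set.univ (fun k => score m (p a.1.1) (a.1.2.1 k).1 (a.1.2.1 k).2) i} :=
      measurableSet_isStrictMin (fun _ => MeasurableSet.const _)
        fun k => measurable_score_comp hm hp (by fun_prop) (by fun_prop) (by fun_prop)
    have h3 : ∀ i, MeasurableSet {a : (𝒳 × ((ℕ → 𝒰 × ℝ≥0) × (ℕ → Fin J))) × V |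
        ∃ k, IsStrictMin {l | a.1.2.2 l = gr k} (fun l => g k a.2 (a.1.2.1 l)) i} := by
      intro i
      rw [Set.ofPred_exists]
      exact MeasurableSet.iUnion fun k => measurableSet_isStrictMin
        (fun l => (show Measurable fun a : (𝒳 × ((ℕ → 𝒰 × ℝ≥0) × (ℕ → Fin J))) × V =>
          a.1.2.2 l by fun_prop) (MeasurableSet.singleton (gr k)))
        (fun l => (hg k).comp (f := fun a : (𝒳 × ((ℕ → 𝒰 × ℝ≥0) × (ℕ → Fin J))) × V =>
          (a.2, a.1.2.1 l)) (by fun_prop)) i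
    refine h1.inter ?_
    have h4 := MeasurableSet.iUnion fun i => (h2 i).inter (h3 i)
    have h5 : {a : (𝒳 × ((ℕ → 𝒰 × ℝ≥0) × (ℕ → Fin J))) × V | ∃ i, IsStrictMin Set.univ
        (fun k => score m (p a.1.1) (a.1.2.1 k).1 (a.1.2.1 k).2) i ∧
        ∃ k, IsStrictMin {l | a.1.2.2 l = gr k} (fun l => g k a.2 (a.1.2.1 l)) i} =
        ⋃ i, ({a | IsStrictMin Set.univ
          (fun k => score m (p a.1.1) (a.1.2.1 k).1 (a.1.2.1 k).2) i} ∩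
          {a | ∃ k, IsStrictMin {l | a.1.2.2 l = gr k} (fun l => g k a.2 (a.1.2.1 l)) i}) := by
      ext a
      simp only [Set.mem_iUnion]
      rfl
    rw [← h5] at h4
    exact h4
  -- A lower bound, given the points, for the probability that the selected point has label `j` and
  -- is found by a decoder of group `j`; the supremum keeps the best single decoder.
  let S : Fin J → ((𝒰 × ℝ≥0) × Measure (𝒰 × ℝ≥0)) × V → ℝ≥0∞ := fun j a =>
    ⨆ k, ⨆ _ : gr k = j,
      (J : ℝ≥0∞)⁻¹ * thin J (locFin ν a.1.2 {y | g k a.2 y ≤ g k a.2 a.1.1})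
  have hS : ∀ j, Measurable (S j) := fun j => Measurable.iSup fun k => Measurable.iSup fun _ =>
    ((measurable_thin J).comp (measurable_locFin_sublevel (hg k))).const_mul _
  let R : 𝒳 → Fin J → 𝒰 × V → ℝ≥0∞ := fun x j a =>
    ⨅ k, ⨅ _ : gr k = j, ratio (p x a.1) (q k a.2 a.1)
  have hR : ∀ x j, Measurable (R x j) := by
    intro x j
    refine Measurable.iInf fun k => Measurable.iInf fun _ => ?_
    have e1 : Measurable fun a : 𝒰 × V => p x a.1 :=
      hp.comp (f := fun a : 𝒰 × V => (x, a.1)) (by fun_prop)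
    have e2 : Measurable fun a : 𝒰 × V => q k a.2 a.1 :=
      (hq k).comp (f := fun a : 𝒰 × V => (a.2, a.1)) (by fun_prop)
    unfold ratio
    fun_prop
  have hDx : ∀ x, Measurable fun a : 𝒰 × V => D.indicator (1 : (𝒳 × 𝒰) × V → ℝ≥0∞)
      ((x, a.1), a.2) := fun x => (measurable_one.indicator hD).comp (by fun_prop)
  -- These choices of `G` and `c` give the quotients `J⁻¹ / (1 + R / J) = (J + R)⁻¹`.
  have key := h.lintegral_div_le_measure hm hp hPU hY hB
    (Λ := fun x a => D.indicator 1 ((x, a.1.1.1), a.2) * ∑ j, S j a) (ι := Fin J)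
    (G := fun x _ a => D.indicator 1 ((x, a.1), a.2) * (J : ℝ≥0∞)⁻¹)
    (c := fun x j a => 1 + R x j a / J)
    (fun x => ((measurable_one.indicator hD).comp (by fun_prop)).mul
      (Finset.measurable_fun_sum _ fun j _ => hS j)) ?_
    (fun x _ => (hDx x).mul_const _)
    (fun x j => ((hR x j).div_const _).const_add _) (fun _ _ _ => by simp) ?_
  · refine le_trans (le_of_eq ?_) key
    refine lintegral_congr fun x => lintegral_congr fun u => lintegral_congr fun v => ?_
    rw [Finset.mul_sum]
    refine Finset.sum_congr rfl fun j _ => ?_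
    rw [← inv_div_one_add_div hJ, mul_div_assoc]
  · intro x
    filter_upwards [h.poisson.ae_locFin_eq] with ω hω i hi v
    by_cases hiD : ((x, (ξ i ω).1), v) ∈ D
    swap
    · simp only [Set.indicator_of_notMem hiD, zero_mul]; exact zero_le
    simp only [Set.indicator_of_mem hiD, Pi.one_apply, one_mul]
    let W : Set Ω := {ω' | ∃ k, IsStrictMin {l | Z l ω' = gr k} (fun l => g k v (ξ l ω)) i}
    have hWB : W ⊆ {ω' | ((x, ((fun k => ξ k ω), fun k => Z k ω')), v) ∈ B} := by
      refine fun ω' hω' => ⟨?_, i, hi, hω'⟩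
      simpa only [selected_eq (e := fun k => ξ k ω) hi] using hiD
    refine le_trans ?_ (measure_mono hWB)
    have hZi : ∀ j, MeasurableSet (Z i ⁻¹' {j}) := fun j =>
      h.measurable_label i (MeasurableSet.singleton j)
    -- Split the success event by the label of the selected point; its part with label `j` is
    -- bounded below using any decoder of group `j`.
    have hsum := sum_measure_preimage_singleton (μ := Pr.restrict W) (Finset.univ : Finset (Fin J))
      (f := Z i) fun j _ => hZi j
    simp only [Finset.coe_univ, Set.preimage_univ, Measure.restrict_apply_univ] at hsum
    rw [← hsum]
    refine Finset.sum_le_sum fun j _ => iSup₂_le fun k hk => ?_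
    rw [Measure.restrict_apply (hZi j)]
    simp only [hω.1 i]
    rw [deletedMeasure_apply_eq_tsum ξ i ω (measurableSet_le (hgv k v) measurable_const)]
    refine (inv_mul_thin_le_measure_labels h.measurable_label h.hasLaw_label h.indep_label i j
      (I := {l | l ≠ i ∧ ξ l ω ∈ {y | g k v y ≤ g k v (ξ i ω)}}) (fun h' => h'.1 rfl)).trans
      (measure_mono fun ω' hω' => ⟨hω'.1, k, ?_, fun l hl hli => ?_⟩)
    · exact hω'.1.trans hk.symm
    · by_contra hlt
      exact hω'.2 l ⟨hli, not_lt.1 hlt⟩ (Eq.trans hl hk)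
  · filter_upwards [hPU, ae_all_iff.2 hQ] with x hx hQx
    have hpx : Measurable (p x) := hp.comp measurable_prodMk_left
    have : IsProbabilityMeasure (θ.withDensity fun u => (p x u : ℝ≥0∞)) := by
      rw [← hx.1]; infer_instance
    rw [hx.1] at hQx
    have hQx' := ae_all_iff.2 hQx
    filter_upwards [ae_of_score_lt_top hm hpx hQx', ae_score_numerator_ne_zero hm]
      with z hz hz0 hlt
    obtain ⟨hmz, htz, hpz, hqz⟩ := hz hlt
    filter_upwards [ae_all_iff.2 hqz] with v hv
    by_cases hzD : ((x, z.1), v) ∈ D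
    swap
    · simp [Set.indicator_of_notMem hzD]
    simp only [Set.indicator_of_mem hzD, Pi.one_apply, one_mul]
    have hN := measurable_pointMeasure h.poisson.measurable
    have hsub : MeasurableSet {y : 𝒰 × ℝ≥0 | score m (p x) y.1 y.2 ≤ score m (p x) z.1 z.2} :=
      measurableSet_le (by fun_prop) measurable_const
    have hisZ : Measurable fun ω => isZero (pointMeasure ξ ω
        {y | score m (p x) y.1 y.2 ≤ score m (p x) z.1 z.2}) :=
      measurable_isZero.comp ((Measure.measurable_coe hsub).comp hN)
    have hSω : ∀ j, Measurable fun ω => S j ((z, pointMeasure ξ ω), v) := fun j =>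
      (hS j).comp ((measurable_const.prodMk hN).prodMk measurable_const)
    simp_rw [Finset.mul_sum]
    have hmul : ∀ j, Measurable fun ω => isZero (pointMeasure ξ ω
        {y | score m (p x) y.1 y.2 ≤ score m (p x) z.1 z.2}) * S j ((z, pointMeasure ξ ω), v) :=
      fun j => hisZ.mul (hSω j)
    rw [lintegral_finsetSum _ fun j _ => hmul j]
    refine Finset.sum_le_sum fun j _ => ?_
    have hf0 : score m (p x) z.1 z.2 ≠ 0 := by
      rw [score]
      exact (ENNReal.div_pos (by simp [hmz, htz]) (by simp)).ne'
    -- A group without decoders has infimum `⊤`, and its term is zero because the score is nonzero.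
    by_cases hj : ∃ k, gr k = j
    swap
    · have hRtop : R x j (z.1, v) = ⊤ := by
        simp only [R, iInf_eq_top]
        exact fun k hk => absurd ⟨k, hk⟩ hj
      rw [hRtop, ENNReal.top_div_of_ne_top (by simp), add_top, ENNReal.top_mul hf0]
      simp
    obtain ⟨k₀, hk₀⟩ := hj
    have : Nonempty {k // gr k = j} := ⟨⟨k₀, hk₀⟩⟩
    -- The group is finite, so some decoder attains the least ratio; its event is the one estimated.
    obtain ⟨⟨k, hk⟩, hkR⟩ := exists_eq_ciInf_of_finite
      (f := fun k : {k // gr k = j} => ratio (p x z.1) (q k v z.1))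
    have hRk : R x j (z.1, v) = ratio (p x z.1) (q k v z.1) := by
      simp only [R]
      rw [hkR, iInf_subtype']
    have hqk : Measurable (q k v) := (hq k).comp measurable_prodMk_left
    have := hv k
    calc (J : ℝ≥0∞)⁻¹ * expNeg ((1 + R x j (z.1, v) / J) * score m (p x) z.1 z.2)
        ≤ (J : ℝ≥0∞)⁻¹ * expNeg (ν {y | score m (p x) y.1 y.2 ≤ score m (p x) z.1 z.2} +
            ν {y | g k v y ≤ g k v z} / J) := by
          gcongr
          refine expNeg_antitone ?_
          -- Changing density turns `R` times the `p`-score into the `q`-score of this decoder, so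
          -- the exponent bounds the two intensities separately.
          have e1 : (1 + R x j (z.1, v) / J) * score m (p x) z.1 z.2 =
              score m (p x) z.1 z.2 + g k v z / J := by
            have : g k v z = ratio (p x z.1) (q k v z.1) * score m (p x) z.1 z.2 :=
              score_eq_ratio_mul hpz
            rw [this, ← hRk, add_mul, one_mul, ENNReal.mul_div_right_comm]
          rw [e1]
          gcongr
          · exact measure_score_le hm hpx _
          · exact measure_score_le hm hqk _
      _ ≤ (J : ℝ≥0∞)⁻¹ * ∫⁻ ω, isZero (pointMeasure ξ ω
            {y | score m (p x) y.1 y.2 ≤ score m (p x) z.1 z.2}) *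
              thin J (pointMeasure ξ ω {y | g k v y ≤ g k v z}) ∂Pr := by
          gcongr
          exact h.poisson.expNeg_le_lintegral hJ hsub
            (measurableSet_le (hgv k v) measurable_const)
      _ = ∫⁻ ω, (J : ℝ≥0∞)⁻¹ * (isZero (pointMeasure ξ ω
            {y | score m (p x) y.1 y.2 ≤ score m (p x) z.1 z.2}) *
              thin J (pointMeasure ξ ω {y | g k v y ≤ g k v z})) ∂Pr := by
          have ht : Measurable fun ω => thin J (pointMeasure ξ ω {y | g k v y ≤ g k v z}) :=
            (measurable_thin J).comp ((Measure.measurable_coe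
              (measurableSet_le (hgv k v) measurable_const)).comp hN)
          have hz : Measurable fun ω => isZero (pointMeasure ξ ω
            {y | score m (p x) y.1 y.2 ≤ score m (p x) z.1 z.2}) *
              thin J (pointMeasure ξ ω {y | g k v y ≤ g k v z}) := hisZ.mul ht
          rw [lintegral_const_mul _ hz]
      _ ≤ _ := by
          refine lintegral_mono_ae ?_
          filter_upwards [h.poisson.ae_locFin_eq] with ω hω
          rw [mul_left_comm]
          gcongr
          simp only [S, hω.2]
          exact le_iSup₂_of_le k hk le_rfl

end Decoding

/-! ### Coordinates of i.i.d. samples -/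

section Iid

variable {α β : Type*} [MeasurableSpace α] [MeasurableSpace β] {κ : Kernel α β}
  [IsMarkovKernel κ] {n : ℕ}

instance : IsMarkovKernel (iidKernel κ n) :=
  ⟨fun a => inferInstanceAs (IsProbabilityMeasure (Measure.pi fun _ : Fin n => κ a))⟩

lemma iidKernel_map_eval (k : Fin n) : (iidKernel κ n).map (fun v => v k) = κ := by
  ext1 a
  rw [Kernel.map_apply _ (measurable_pi_apply k)]
  exact (measurePreserving_eval (fun _ : Fin n => κ a) k).map_eq

lemma ae_iidKernel {a : α} {φ : β → Prop} (h : ∀ᵐ y ∂κ a, φ y) (k : Fin n) :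
    ∀ᵐ v ∂iidKernel κ n a, φ (v k) :=
  (measurePreserving_eval (fun _ : Fin n => κ a) k).quasiMeasurePreserving.ae h

end Iid

/-! ### From bounds on events to conditional probabilities -/

/-- A conditional probability is bounded as soon as its integrals over the events of the
conditioning `σ`-algebra are. -/
lemma condExp_le_one_sub {Ω β : Type*} [MeasurableSpace Ω] [MeasurableSpace β] {Pr : Measure Ω}
    [IsProbabilityMeasure Pr] {W : Ω → β} (hW : Measurable W) {F : Set Ω} (hF : MeasurableSet F)
    {f : β → ℝ≥0∞} (hf : Measurable f)
    (h : ∀ D, MeasurableSet D → ∫⁻ ω in W ⁻¹' D, f (W ω) ∂Pr ≤ Pr (W ⁻¹' D \ F)) :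
    Pr⟦F | MeasurableSpace.comap W inferInstance⟧ ≤ᵐ[Pr] fun ω => 1 - (f (W ω)).toReal := by
  have hm := hW.comap_le
  have hfW : Measurable fun ω => f (W ω) := hf.comp hW
  have hint : Integrable (fun ω => (f (W ω)).toReal) Pr := by
    refine integrable_toReal_of_lintegral_ne_top hfW.aemeasurable (ne_of_lt ?_)
    have := h Set.univ MeasurableSet.univ
    simp only [Set.preimage_univ, Measure.restrict_univ] at this
    exact (this.trans prob_le_one).trans_lt ENNReal.one_lt_top
  have hint' : Integrable (fun ω => 1 - (f (W ω)).toReal) Pr := (integrable_const 1).sub hint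
  have hs : StronglyMeasurable[MeasurableSpace.comap W inferInstance]
      fun ω => 1 - (f (W ω)).toReal := by
    have h0 : Measurable[MeasurableSpace.comap W inferInstance] W := comap_measurable W
    have h1 : Measurable fun b => 1 - (f b).toReal := hf.ennreal_toReal.const_sub 1
    exact (h1.comp h0).stronglyMeasurable
  have hFint : Integrable (F.indicator fun _ => (1 : ℝ)) Pr :=
    (integrable_const 1).indicator hF
  -- Both sides are measurable for the conditioning `σ`-algebra, so they can be compared through
  -- integrals over the sets `W ⁻¹' D`.
  refine ae_le_of_ae_le_trim (hm := hm) ?_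
  suffices h' : 0 ≤ᵐ[Pr.trim hm] (fun ω => 1 - (f (W ω)).toReal) -
      Pr⟦F | MeasurableSpace.comap W inferInstance⟧ by
    filter_upwards [h'] with ω hω
    exact sub_nonneg.1 hω
  refine ae_nonneg_of_forall_setIntegral_nonneg
    ((hint'.sub integrable_condExp).trim hm (hs.sub stronglyMeasurable_condExp)) fun s hs' _ => ?_
  rw [← setIntegral_trim hm (hs.sub stronglyMeasurable_condExp) hs',
    integral_sub' hint'.integrableOn integrable_condExp.integrableOn, sub_nonneg,
    setIntegral_condExp hm hFint hs']
  obtain ⟨D, hD, rfl⟩ := hs'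
  have hWD : MeasurableSet (W ⁻¹' D) := hW hD
  rw [integral_sub (integrable_const 1).integrableOn hint.integrableOn, le_sub_iff_add_le,
    setIntegral_indicator hF]
  simp only [integral_const, smul_eq_mul, mul_one, MeasurableSet.univ, measureReal_restrict_apply,
    Set.univ_inter]
  have h1 : ∫ ω in W ⁻¹' D, (f (W ω)).toReal ∂Pr ≤ Pr.real (W ⁻¹' D \ F) := by
    rw [integral_toReal hfW.aemeasurable]
    · exact ENNReal.toReal_mono (measure_ne_top _ _) (h D hD)
    · exact ae_lt_top hfW (ne_top_of_le_ne_top (measure_ne_top _ _) (h D hD))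
  rw [← measureReal_inter_add_sdiff (μ := Pr) (s := W ⁻¹' D) hF]
  exact add_le_add_right h1 _

/-! ### The success bound in terms of `(X, U_p, Y)` -/

section Decoding

variable {Ω 𝒳 𝒰 V : Type*} [MeasurableSpace Ω] [MeasurableSpace 𝒳] [MeasurableSpace 𝒰]
  [MeasurableSpace V] {J : ℕ} {θ : Measure 𝒰} [SigmaFinite θ] {m : 𝒰 → ℝ≥0}
  {Pr : Measure Ω} [IsProbabilityMeasure Pr]
  {ξ : ℕ → Ω → 𝒰 × ℝ≥0} {Z : ℕ → Ω → Fin J} {X : Ω → 𝒳} {PX : Measure 𝒳}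
  {PU : Kernel 𝒳 𝒰} [IsMarkovKernel PU] {p : 𝒳 → 𝒰 → ℝ≥0}
  {κ : Kernel (𝒳 × 𝒰) V} [IsMarkovKernel κ] {Yv : Ω → V}

lemma IsCodebook.hasLaw_prodMk [NeZero J]
    (h : IsCodebook ξ Z X ((θ.withDensity fun u => (m u : ℝ≥0∞)).prod lebesgueNNReal) PX Pr)
    (hm : Measurable m) (hp : Measurable (Function.uncurry p))
    (hPU : ∀ᵐ x ∂PX, PU x = θ.withDensity (fun u => (p x u : ℝ≥0∞)) ∧
      PU x ≪ θ.withDensity fun u => (m u : ℝ≥0∞))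
    (hY : HasCondDistrib Yv
      (fun ω => ((X ω, selected m p (X ω, fun i => ξ i ω)), ((fun i => ξ i ω), fun i => Z i ω)))
      (κ.prodMkRight ((ℕ → 𝒰 × ℝ≥0) × (ℕ → Fin J))) Pr) :
    HasLaw (fun ω => ((X ω, selected m p (X ω, fun i => ξ i ω)), Yv ω))
      ((PX ⊗ₘ PU) ⊗ₘ κ) Pr :=
  (h.hasLaw_selected hm hp hPU hY).prodMk_of_hasCondDistrib
    (HasCondDistrib.comp_right (f := Prod.fst) (hf := measurable_fst) hY)

lemma IsCodebook.setLIntegral_sum_inv_le_measure [NeZero J] {ι : Type*} [Fintype ι]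
    (h : IsCodebook ξ Z X ((θ.withDensity fun u => (m u : ℝ≥0∞)).prod lebesgueNNReal) PX Pr)
    (hm : Measurable m) (hp : Measurable (Function.uncurry p))
    (hPU : ∀ᵐ x ∂PX, PU x = θ.withDensity (fun u => (p x u : ℝ≥0∞)) ∧
      PU x ≪ θ.withDensity fun u => (m u : ℝ≥0∞))
    (hY : HasCondDistrib Yv
      (fun ω => ((X ω, selected m p (X ω, fun i => ξ i ω)), ((fun i => ξ i ω), fun i => Z i ω)))
      (κ.prodMkRight ((ℕ → 𝒰 × ℝ≥0) × (ℕ → Fin J))) Pr) (hYm : Measurable Yv)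
    (gr : ι → Fin J) {q : ι → V → 𝒰 → ℝ≥0} (hq : ∀ k, Measurable (Function.uncurry (q k)))
    (hQ : ∀ k, ∀ᵐ x ∂PX, ∀ᵐ u ∂PU x, ∀ᵐ v ∂κ (x, u),
      IsProbabilityMeasure (θ.withDensity fun u => (q k v u : ℝ≥0∞)))
    {f : (𝒳 × 𝒰) × V → ℝ≥0∞} (hfm : Measurable f) (hf : ∀ a, f a = ∑ j, ((J : ℝ≥0∞) +
        ⨅ k, ⨅ _ : gr k = j, ratio (p a.1.1 a.1.2) (q k a.2 a.1.2))⁻¹)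
    {D : Set ((𝒳 × 𝒰) × V)} (hD : MeasurableSet D) :
    ∫⁻ ω in (fun ω => ((X ω, selected m p (X ω, fun i => ξ i ω)), Yv ω)) ⁻¹' D,
        f ((X ω, selected m p (X ω, fun i => ξ i ω)), Yv ω) ∂Pr ≤
      Pr {ω | ((X ω, selected m p (X ω, fun i => ξ i ω)), Yv ω) ∈ D ∧
        ∃ i, IsStrictMin Set.univ (fun k => score m (p (X ω)) (ξ k ω).1 (ξ k ω).2) i ∧
          ∃ k, IsStrictMin {l | Z l ω = gr k}
            (fun l => score m (q k (Yv ω)) (ξ l ω).1 (ξ l ω).2) i} := by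
  refine le_trans (le_of_eq ?_) (h.lintegral_sum_inv_le_measure hm hp hPU hY gr hq hQ hD)
  have := h.isProbabilityMeasure_input
  have hsel := measurable_selected hm hp
  have hX := h.measurable_input
  have hξ := h.measurable_points
  have hW : Measurable fun ω => ((X ω, selected m p (X ω, fun i => ξ i ω)), Yv ω) :=
    (hX.prodMk (hsel.comp (hX.prodMk hξ))).prodMk hYm
  have hDf : Measurable fun a => D.indicator 1 a * f a := (measurable_one.indicator hD).mul hfm
  rw [← lintegral_indicator (hW hD)]
  calc _ = ∫⁻ ω, (fun a => D.indicator 1 a * f a)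
        ((X ω, selected m p (X ω, fun i => ξ i ω)), Yv ω) ∂Pr := by
        refine lintegral_congr fun ω => ?_
        by_cases hω : ((X ω, selected m p (X ω, fun i => ξ i ω)), Yv ω) ∈ D
        · simp [Set.indicator, hω]
        · simp [Set.indicator, hω]
    _ = _ := by
        rw [← lintegral_map hDf hW, (h.hasLaw_prodMk hm hp hPU hY).map_eq,
          Measure.lintegral_compProd hDf, Measure.lintegral_compProd]
        · simp_rw [hf]
        · exact hDf.lintegral_kernel_prod_right'

end Decoding

/-! ### Assembly of the theorem -/

lemma ae_density_of_ae_snd {𝒳 𝒰 𝒴 : Type*} [MeasurableSpace 𝒳] [MeasurableSpace 𝒰]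
    [MeasurableSpace 𝒴] {PX : Measure 𝒳} [IsProbabilityMeasure PX] {PU : Kernel 𝒳 𝒰}
    [IsMarkovKernel PU] {PY : Kernel (𝒳 × 𝒰) 𝒴} [IsMarkovKernel PY] {n : ℕ} {φ : 𝒴 → Prop}
    (h : ∀ᵐ y ∂((PX ⊗ₘ PU) ⊗ₘ PY).snd, φ y) (k : Fin n) :
    ∀ᵐ x ∂PX, ∀ᵐ u ∂PU x, ∀ᵐ v ∂iidKernel PY n (x, u), φ (v k) := by
  have h1 : ∀ᵐ a ∂(PX ⊗ₘ PU) ⊗ₘ PY, φ a.2 := ae_of_ae_map measurable_snd.aemeasurable h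
  filter_upwards [Measure.ae_ae_of_ae_compProd (Measure.ae_ae_of_ae_compProd h1)] with x hx
  filter_upwards [hx] with u hu
  exact ae_iidKernel hu k

lemma measurable_sum_inv_add_iInf_ratio {𝒳 𝒰 V ι : Type*} [MeasurableSpace 𝒳]
    [MeasurableSpace 𝒰] [MeasurableSpace V] [Countable ι] {J : ℕ} (gr : ι → Fin J)
    {p : 𝒳 → 𝒰 → ℝ≥0} (hp : Measurable (Function.uncurry p))
    {q : ι → V → 𝒰 → ℝ≥0} (hq : ∀ k, Measurable (Function.uncurry (q k))) :
    Measurable fun a : (𝒳 × 𝒰) × V => ∑ j, ((J : ℝ≥0∞) +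
        ⨅ k, ⨅ _ : gr k = j, ratio (p a.1.1 a.1.2) (q k a.2 a.1.2))⁻¹ := by
  refine Finset.measurable_fun_sum _ fun j _ => (Measurable.const_add ?_ _).inv
  refine Measurable.iInf fun k => Measurable.iInf fun _ => ?_
  have e1 : Measurable fun a : (𝒳 × 𝒰) × V => p a.1.1 a.1.2 := hp.comp measurable_fst
  have e2 : Measurable fun a : (𝒳 × 𝒰) × V => q k a.2 a.1.2 :=
    (hq k).comp (f := fun a : (𝒳 × 𝒰) × V => (a.2, a.1.2)) (by fun_prop)
  unfold ratio
  fun_prop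

/-- For `L = 1` the map `Fin.divNat` is a bijection, so each group holds one decoder and its infimum
is a single value. -/
lemma sum_divNat_iInf {J : ℕ} {c : ℝ≥0∞ → ℝ} (r : Fin (J * 1) → ℝ≥0∞) :
    ∑ j : Fin J, c (⨅ k : Fin (J * 1), ⨅ _ : k.divNat = j, r k) = ∑ k, c (r k) := by
  have hinj : Function.Injective (Fin.divNat : Fin (J * 1) → Fin J) := fun a b hab => by
    have := congrArg Fin.val hab
    simp only [Fin.coe_divNat, Nat.div_one] at this
    exact Fin.ext this
  have hbij : Function.Bijective (Fin.divNat : Fin (J * 1) → Fin J) :=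
    (Fintype.bijective_iff_injective_and_card _).2 ⟨hinj, by simp⟩
  rw [← hbij.sum_comp]
  refine Finset.sum_congr rfl fun k _ => congrArg c ?_
  refine le_antisymm (iInf₂_le_of_le k rfl le_rfl) (le_iInf₂ fun l hl => ?_)
  rw [hinj hl]

end ListPML

theorem lemma2
    {Ω 𝒳 𝒰 𝒴 : Type*} [MeasurableSpace Ω]
    [MeasurableSpace 𝒳] [StandardBorelSpace 𝒳]
    [MeasurableSpace 𝒰] [StandardBorelSpace 𝒰]
    [MeasurableSpace 𝒴] [StandardBorelSpace 𝒴]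
    (Pr : Measure Ω) [IsProbabilityMeasure Pr]
    (J L : ℕ)
    -- the reference measure `θ` on `𝒰`, and the measure `μ` with its density `m`
    (θ μ : Measure 𝒰) [SigmaFinite θ]
    (m : 𝒰 → ℝ≥0) (hm : Measurable m) (hμ : μ = θ.withDensity fun u => (m u : ℝ≥0∞))
    -- the joint distribution `P_{X,U,Y}` with its conditional distributions
    -- `P_{U|X}` and `P_{Y|X,U}`, and the density `p` of `P_{U|X}`
    (P : Measure ((𝒳 × 𝒰) × 𝒴)) [IsProbabilityMeasure P]
    (PU : Kernel 𝒳 𝒰) [IsMarkovKernel PU] (PY : Kernel (𝒳 × 𝒰) 𝒴) [IsMarkovKernel PY]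
    (hP : P = (P.fst.fst ⊗ₘ PU) ⊗ₘ PY)
    (p : 𝒳 → 𝒰 → ℝ≥0) (hp : Measurable (Function.uncurry p))
    (hPU : ∀ᵐ x ∂P.fst.fst, PU x = θ.withDensity (fun u => (p x u : ℝ≥0∞)) ∧ PU x ≪ μ)
    -- the probability kernel `Q_{U|Y}` with its density `q`
    (Q : Kernel 𝒴 𝒰) [IsMarkovKernel Q]
    (q : 𝒴 → 𝒰 → ℝ≥0) (hq : Measurable (Function.uncurry q))
    (hQ : ∀ᵐ y ∂P.snd, Q y = θ.withDensity (fun u => (q y u : ℝ≥0∞)) ∧ Q y ≪ μ)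
    -- the Poisson process `Π = {(U_i, T_i)}`, its labels `Z_i`, and `X`
    (U : ℕ → Ω → 𝒰) (T : ℕ → Ω → ℝ≥0)
    (hUT : ListPML.IsPoissonProcess (fun i ω => (U i ω, T i ω)) (μ.prod ListPML.lebesgueNNReal) Pr)
    (Z : ℕ → Ω → Fin J) (hZ : ∀ i, Measurable (Z i))
    (hZunif : ∀ i, HasLaw (Z i) (uniformOn Set.univ) Pr)
    (hZindep : iIndepFun Z Pr)
    (hZUT : IndepFun (fun ω i => Z i ω) (fun ω i => (U i ω, T i ω)) Pr)
    (X : Ω → 𝒳) (hX : Measurable X) (hXlaw : HasLaw X P.fst.fst Pr)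
    (hXUT : IndepFun X (fun ω => ((fun i => (U i ω, T i ω)), fun i => Z i ω)) Pr)
    -- the encoder
    (Kp : Ω → ℕ)
    (hKp : ∀ ω, Kp ω =
      ListPML.argmin Set.univ (fun i => ListPML.score m (p (X ω)) (U i ω) (T i ω)))
    (Up : Ω → 𝒰) (hUp : ∀ ω, Up ω = U (Kp ω) ω)
    -- given `X`, `Π` and the labels, the observations are i.i.d. with law `P_{Y|X,U}(· | X, U_p)`
    (Y : Fin (J * L) → Ω → 𝒴) (hY : ∀ k, Measurable (Y k))
    (hYlaw : HasCondDistrib (fun ω k => Y k ω)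
      (fun ω => ((X ω, Up ω), ((fun i => (U i ω, T i ω)), fun i => Z i ω)))
      ((ListPML.iidKernel PY (J * L)).prodMkRight ((ℕ → 𝒰 × ℝ≥0) × (ℕ → Fin J))) Pr)
    -- the decoders; counting from `0`, decoder `k` belongs to group `k / L`, which is `k.divNat`
    (Kq : Fin (J * L) → Ω → ℕ)
    (hKq : ∀ k ω, Kq k ω =
      ListPML.argmin {i | Z i ω = k.divNat}
        (fun i => ListPML.score m (q (Y k ω)) (U i ω) (T i ω)))
    (Uq : Fin (J * L) → Ω → 𝒰) (hUq : ∀ k ω, Uq k ω = U (Kq k ω) ω) :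
    -- the selection rules are almost surely unambiguous, and the outputs are random variables
    (∀ᵐ ω ∂Pr, ∃! i, ListPML.IsMinimizer Set.univ
      (fun i => ListPML.score m (p (X ω)) (U i ω) (T i ω)) i) ∧
    (∀ k, ∀ᵐ ω ∂Pr, ∃! i, ListPML.IsMinimizer {i | Z i ω = k.divNat}
      (fun i => ListPML.score m (q (Y k ω)) (U i ω) (T i ω)) i) ∧
    Measurable Up ∧ (∀ k, Measurable (Uq k)) ∧
    -- `(X, U_p, Y_k)` has law `P_{X,U,Y}`
    (∀ k, HasLaw (fun ω => ((X ω, Up ω), Y k ω)) P Pr) ∧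
    -- the bound on the conditional error probability
    (Pr⟦{ω | Up ω ∉ Set.range fun k => Uq k ω} |
        MeasurableSpace.comap (fun ω => (X ω, Up ω, fun k => Y k ω)) inferInstance⟧
      ≤ᵐ[Pr] fun ω => 1 - ∑ j : Fin J,
        (((J : ℝ≥0∞) + ⨅ k : Fin (J * L), ⨅ _ : k.divNat = j,
          ListPML.ratio (p (X ω) (Up ω)) (q (Y k ω) (Up ω)))⁻¹).toReal) ∧
    -- the case of disjoint codebooks, `L = 1`
    (L = 1 →
      Pr⟦{ω | Up ω ∉ Set.range fun k => Uq k ω} |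
        MeasurableSpace.comap (fun ω => (X ω, Up ω, fun k => Y k ω)) inferInstance⟧
      ≤ᵐ[Pr] fun ω => 1 - ∑ k : Fin (J * L),
        ((((J * L : ℕ) : ℝ≥0∞) +
          ListPML.ratio (p (X ω) (Up ω)) (q (Y k ω) (Up ω)))⁻¹).toReal) := by
  subst hμ
  have : Nonempty Ω := nonempty_of_isProbabilityMeasure Pr
  -- The label of any point is an element of `Fin J`, which is therefore nonempty.
  have : NeZero J := ⟨fun h => by subst h; exact (Z 0 (Classical.arbitrary Ω)).elim0⟩
  have hcode : ListPML.IsCodebook (fun i ω => (U i ω, T i ω)) Z X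
      ((θ.withDensity fun u => (m u : ℝ≥0∞)).prod ListPML.lebesgueNNReal) P.fst.fst Pr :=
    ⟨hUT, hZ, hZunif, hZindep, hZUT, hX, hXlaw, hXUT⟩
  have hξ := hcode.measurable_points
  have hU : ∀ i, Measurable (U i) := fun i => (hUT.measurable i).fst
  have hT : ∀ i, Measurable (T i) := fun i => (hUT.measurable i).snd
  have hsel := ListPML.measurable_selected hm hp
  have hUp' : ∀ ω, Up ω = ListPML.selected m p (X ω, fun i => (U i ω, T i ω)) := fun ω => by
    rw [hUp, hKp, ListPML.selected]
  simp only [hUp'] at hYlaw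
  have hYm : Measurable fun ω k => Y k ω := measurable_pi_iff.2 hY
  have hqk : ∀ k : Fin (J * L), Measurable
      (Function.uncurry fun (v : Fin (J * L) → 𝒴) u => q (v k) u) := fun k =>
    hq.comp (f := fun a : (Fin (J * L) → 𝒴) × 𝒰 => (a.1 k, a.2)) (by fun_prop)
  have hQ' : ∀ᵐ y ∂((P.fst.fst ⊗ₘ PU) ⊗ₘ PY).snd,
      IsProbabilityMeasure (θ.withDensity fun u => (q y u : ℝ≥0∞)) ∧
      (θ.withDensity fun u => (q y u : ℝ≥0∞)) ≪ θ.withDensity fun u => (m u : ℝ≥0∞) := by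
    rw [← hP]
    filter_upwards [hQ] with y hy
    rw [← hy.1]
    exact ⟨inferInstance, hy.2⟩
  have hQk := fun k : Fin (J * L) => ListPML.ae_density_of_ae_snd hQ' k
  have hmin := hcode.ae_exists_isStrictMin hm hp hPU hYlaw
  have hminq := fun k : Fin (J * L) =>
    hcode.ae_exists_isStrictMin_label hm hp hPU hYlaw hYm (hqk k) (hQk k) k.divNat
  have hUpm : Measurable Up := by
    rw [funext hUp']
    exact hsel.comp (hX.prodMk hξ)
  have hUqm : ∀ k, Measurable (Uq k) := fun k => by
    have h1 : Measurable (Kq k) := by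
      rw [funext (hKq k)]
      exact ListPML.measurable_argmin (fun i => hZ i (MeasurableSet.singleton _))
        fun i => ListPML.measurable_score_comp hm hq (hY k) (hU i) (hT i)
    rw [funext (hUq k)]
    exact ListPML.measurable_eval_nat hU h1
  let F : Set Ω := {ω | Up ω ∉ Set.range fun k => Uq k ω}
  have hF : MeasurableSet F := by
    have h1 : F = (⋃ k, {ω | Uq k ω = Up ω})ᶜ := by
      ext ω
      simp [F]
    rw [h1]
    exact (MeasurableSet.iUnion fun k => measurableSet_eq_fun (hUqm k) hUpm).compl
  let f : (𝒳 × 𝒰) × (Fin (J * L) → 𝒴) → ℝ≥0∞ := fun a => ∑ j, ((J : ℝ≥0∞) +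
    ⨅ k : Fin (J * L), ⨅ _ : k.divNat = j, ListPML.ratio (p a.1.1 a.1.2) (q (a.2 k) a.1.2))⁻¹
  have hf : Measurable f := ListPML.measurable_sum_inv_add_iInf_ratio
    (q := fun k (v : Fin (J * L) → 𝒴) u => q (v k) u) Fin.divNat hp hqk
  have hbound : Pr⟦F | MeasurableSpace.comap (fun ω =>
      (X ω, Up ω, fun k => Y k ω)) inferInstance⟧
      ≤ᵐ[Pr] fun ω => 1 - ∑ j : Fin J, (((J : ℝ≥0∞) + ⨅ k : Fin (J * L), ⨅ _ : k.divNat = j,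
        ListPML.ratio (p (X ω) (Up ω))
          (q (Y k ω) (Up ω)))⁻¹).toReal := by
    have hW : Measurable fun ω => (X ω, Up ω, fun k => Y k ω) := hX.prodMk (hUpm.prodMk hYm)
    have h1 := ListPML.condExp_le_one_sub (Pr := Pr) hW hF
      (f := fun a => f ((a.1, a.2.1), a.2.2)) (hf.comp (by fun_prop)) ?_
    · refine h1.trans (Filter.Eventually.of_forall fun ω => ?_)
      simp only [f]
      rw [ENNReal.toReal_sum fun j _ => by simp [NeZero.ne J]]
    · intro D hD
      have hD' : MeasurableSet ((fun a : (𝒳 × 𝒰) × (Fin (J * L) → 𝒴) =>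
          (a.1.1, a.1.2, a.2)) ⁻¹' D) :=
        (show Measurable fun a : (𝒳 × 𝒰) × (Fin (J * L) → 𝒴) =>
          (a.1.1, a.1.2, a.2) by fun_prop) hD
      have h2 := hcode.setLIntegral_sum_inv_le_measure hm hp hPU hYlaw hYm
        (q := fun k (v : Fin (J * L) → 𝒴) u => q (v k) u) Fin.divNat hqk (f := f)
        (fun k => (hQk k).mono fun _ hx => hx.mono fun _ hu => hu.mono fun _ hv => hv.1) hf (fun _ => rfl) hD'
      simp only [← hUp'] at h2
      refine h2.trans (measure_mono fun ω hω => ?_)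
      obtain ⟨hωD, i, hi, k, hk⟩ := hω
      -- The encoder and decoder `k` have the same strict minimizer `i`, so both outputs are `U i
      -- ω`.
      refine ⟨hωD, fun hωF => hωF ⟨k, ?_⟩⟩
      simp only
      rw [hUp', ListPML.selected_eq (e := fun i => (U i ω, T i ω)) hi, hUq, hKq, hk.argmin_eq]
  refine ⟨?_, fun k => ?_, hUpm, hUqm, fun k => ?_, hbound, fun hL => ?_⟩
  · filter_upwards [hmin] with ω hω
    exact hω.choose_spec.existsUnique
  · filter_upwards [hminq k] with ω hω
    exact hω.choose_spec.existsUnique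
  · rw [hP]
    -- Given `X` and `U_p`, the `k`-th coordinate of the i.i.d. sample has law `PY`.
    have h1 := (hcode.hasLaw_selected hm hp hPU hYlaw).prodMk_of_hasCondDistrib
      (HasCondDistrib.comp_left (HasCondDistrib.comp_right (f := Prod.fst)
        (hf := measurable_fst) hYlaw) (measurable_pi_apply k))
    simp only [← hUp'] at h1
    rwa [ListPML.iidKernel_map_eval] at h1
  · subst hL
    refine hbound.trans (Filter.Eventually.of_forall fun ω => le_of_eq ?_)
    have h1 := ListPML.sum_divNat_iInf (J := J)
      (c := fun r => (((J : ℝ≥0∞) + r)⁻¹).toReal) fun k =>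
        ListPML.ratio (p (X ω) (Up ω))
          (q (Y k ω) (Up ω))
    simp only at h1 ⊢
    have h2 : ((J * 1 : ℕ) : ℝ≥0∞) = J := by rw [Nat.mul_one]
    rw [h1, h2]
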